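/- **Conventions.** A simple weighted graph is a finite undirected graph without loops or multiple edges whose edges carry positive real weights. For such a graph $X$, $L(X)=D(X)-A(X)$ is the Laplacian matrix, $A(X)$ being the weighted adjacency matrix and $D(X)$ the diagonal matrix of its row sums. The join $X\vee Y$ is obtained from the disjoint union of $X$ and $Y$ by joining every vertex of $X$ to every vertex of $Y$ by an edge of weight one. $O_2$ is the graph with two vertices and no edges. Two distinct vertices $u,v$ of a graph $Z$ admit Laplacian perfect state transfer (PST) if $|(e^{i\tau L(Z)})_{u,v}|=1$ for some real $\tau$; the least such $\tau>0$ is the minimum PST time. For a real number $\lambda$ let $E_\lambda$ be the orthogonal projection onto the $\lambda$-eigenspace of $L(X)$ ($E_\lambda=0$ if $\lambda$ is not an eigenvalue). Let $$\sigma_u(L(X))=\{\lambda: E_\lambda \mathbf e_u\ne 0\},\qquad \sigma^{\pm}_{uv}(L(X))=\{\lambda: E_\lambda \mathbf e_u=\pm E_\lambda \mathbf e_v\neq 0\}.$$ Vertices $u,v$ are Laplacian strongly cospectral in $X$ if for every $\lambda$ either $E_\lambda \mathbf e_u=E_\lambda \mathbf e_v$ or $E_\lambda \mathbf e_u=-E_\lambda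 \mathbf e_v$. Finally, $\nu_2$ is the 2-adic valuation. **Theorem 7.2.** Let $X$ and $Y$ be simple weighted graphs with $m\ge 2$ and $n\geq 1$ vertices respectively, such that the characteristic polynomial $\phi(L(X),t)$ lies in $\mathbb Z[t]$. Let $u\neq v$ be vertices of $X$. Then $u$ and $v$ admit Laplacian perfect state transfer in $X\vee Y$ if and only if all of the following hold. 1. Either (i) $u$ and $v$ are Laplacian strongly cospectral in $X$ and $m\notin\sigma^-_{uv}(L(X))$, or (ii) $X=O_2$. 2. $\sigma_u(L(X))\subseteq\mathbb Z$. 3. One of the following holds. - (a) $X$ is connected and at least one of the following three conditions holds for all nonzero $\lambda\in\sigma^+_{uv}(L(X))\cup\{m\}$ and all $\mu,\theta\in\sigma^-_{uv}(L(X))$: - (i) $\nu_2(\lambda)>\nu_2(\mu)=\nu_2(\theta)$ and $\nu_2(n)>\nu_2(\mu)$; - (ii) $\nu_2(\mu)>\nu_2(\lambda)=\nu_2(n)$; - (iii) $\nu_2(\lambda)=\nu_2(\mu)=\nu_2(n)$ and $\nu_2\left(\frac{\lambda+n}{2^{\nu_2(n)}}\right)>\nu_2\left(\frac{\mu+n}{2^{\nu_2(n)}}\right)=\nu_2\left(\frac{\theta+n}{2^{\nu_2(n)}}\right)$.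 - (b) $X\neq O_2$ is disconnected and (a)(i) holds for all such $\lambda,\mu,\theta$. - (c) $X=O_2$ and $n\equiv 2\pmod 4$. If PST occurs between $u$ and $v$ in $X\vee Y$ and $X\ne O_2$ is disconnected, then $u$ and $v$ lie in the same connected component of $X$. Whenever PST occurs between $u$ and $v$ in $X\vee Y$, the minimum PST time is $\tau_{X\vee Y}=\pi/g$ with $g=\gcd(\mathcal S\cup\mathcal R)$, where $\mathcal S=\{\lambda+n:\lambda\in\sigma_u(L(X)),\ \lambda\neq 0\}$, and $\mathcal R=\{0,m+n\}$ if $X$ is connected, $\mathcal R=\{0,m+n,n\}$ otherwise. -/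

import Mathlib

noncomputable section

/-- A simple weighted undirected graph on the vertex set `V`: no loops, no multiple edges, and
positive real edge weights.  The weight `w u v` is `0` exactly when `u` and `v` are not adjacent. -/
structure WGraph (V : Type*) where
  w : V → V → ℝ
  symm : ∀ u v, w u v = w v u
  nonneg : ∀ u v, 0 ≤ w u v
  loopless : ∀ u, w u u = 0

namespace WGraph

/-- The underlying simple graph: vertices are adjacent when the weight of their edge is positive. -/
def graph {V : Type*} (X : WGraph V) : SimpleGraph V where
  Adj u v := 0 < X.w u v
  symm := ⟨fun u v h => by rw [X.symm v u]; exact h⟩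
  loopless := ⟨fun u h => by rw [X.loopless u] at h; exact lt_irrefl _ h⟩

/-- `X` is the empty graph `O_2` on two vertices. -/
def IsO2 {V : Type*} [Fintype V] (X : WGraph V) : Prop :=
  Fintype.card V = 2 ∧ X.graph = ⊥

/-- The weighted adjacency matrix. -/
def adj {V : Type*} (X : WGraph V) : Matrix V V ℝ := Matrix.of X.w

/-- The weighted degree of a vertex (there are no loops). -/
def deg {V : Type*} [Fintype V] (X : WGraph V) (u : V) : ℝ := ∑ v, X.w u v

/-- The Laplacian matrix `L = D - A`. -/
def lap {V : Type*} [Fintype V] [DecidableEq V] (X : WGraph V) : Matrix V V ℝ :=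
  Matrix.diagonal X.deg - X.adj

/-- The weights of the join `X ∨ Y`: those of `X` and of `Y`, and one between the two parts. -/
def joinWeight {V W : Type*} (X : WGraph V) (Y : WGraph W) : V ⊕ W → V ⊕ W → ℝ
  | Sum.inl u, Sum.inl v => X.w u v
  | Sum.inr u, Sum.inr v => Y.w u v
  | Sum.inl _, Sum.inr _ => 1
  | Sum.inr _, Sum.inl _ => 1

/-- The join `X ∨ Y`. -/
def join {V W : Type*} (X : WGraph V) (Y : WGraph W) : WGraph (V ⊕ W) where
  w := joinWeight X Y
  symm := by
    rintro (u | u) (v | v)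
    exacts [X.symm u v, rfl, rfl, Y.symm u v]
  nonneg := by
    rintro (u | u) (v | v) <;> simp [joinWeight, X.nonneg, Y.nonneg]
  loopless := by
    rintro (u | u) <;> simp [joinWeight, X.loopless, Y.loopless]

end WGraph

/-- The transition matrix `U_M(t) = exp(i t M)` of the continuous-time quantum walk with
Hamiltonian `M`. -/
def transitionMatrix {V : Type*} [Fintype V] [DecidableEq V] (M : Matrix V V ℝ) (t : ℝ) :
    Matrix V V ℂ :=
  NormedSpace.exp ((Complex.I * (t : ℂ)) • M.map (fun x : ℝ => (x : ℂ)))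

/-- Perfect state transfer between `u` and `v` at time `t`. -/
def PSTAt {V : Type*} [Fintype V] [DecidableEq V] (M : Matrix V V ℝ) (u v : V) (t : ℝ) : Prop :=
  ‖transitionMatrix M t u v‖ = 1

/-- Perfect state transfer between `u` and `v` at some time. -/
def PST {V : Type*} [Fintype V] [DecidableEq V] (M : Matrix V V ℝ) (u v : V) : Prop :=
  ∃ t : ℝ, PSTAt M u v t

/-- `τ` is the minimum PST time: the least positive time of perfect state transfer. -/
def IsMinPSTTime {V : Type*} [Fintype V] [DecidableEq V] (M : Matrix V V ℝ) (u v : V) (τ : ℝ) :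
    Prop :=
  IsLeast {t : ℝ | 0 < t ∧ PSTAt M u v t} τ

/-- The vector `E_l e_u`, where `E_l` is the orthogonal projection onto the eigenspace of `M` for
`l`; it is zero if `l` is not an eigenvalue of `M`. -/
def eigProj {V : Type*} [Fintype V] [DecidableEq V] (M : Matrix V V ℝ) (l : ℝ) (u : V) :
    EuclideanSpace ℝ V :=
  (Module.End.eigenspace (Matrix.toEuclideanLin M) l).starProjection (EuclideanSpace.single u 1)

/-- The eigenvalue support `σ_u(M)`. -/
def eigSupport {V : Type*} [Fintype V] [DecidableEq V] (M : Matrix V V ℝ) (u : V) : Set ℝ :=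
  {l | eigProj M l u ≠ 0}

/-- Strong cospectrality: `E_l e_u = ± E_l e_v` for every eigenvalue `l`. -/
def StronglyCospectral {V : Type*} [Fintype V] [DecidableEq V] (M : Matrix V V ℝ) (u v : V) :
    Prop :=
  ∀ l : ℝ, eigProj M l u = eigProj M l v ∨ eigProj M l u = -eigProj M l v

/-- The set `σ⁺_{uv}(M)`. -/
def sigmaPlus {V : Type*} [Fintype V] [DecidableEq V] (M : Matrix V V ℝ) (u v : V) : Set ℝ :=
  {l | eigProj M l u = eigProj M l v ∧ eigProj M l v ≠ 0}

/-- The set `σ⁻_{uv}(M)`. -/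
def sigmaMinus {V : Type*} [Fintype V] [DecidableEq V] (M : Matrix V V ℝ) (u v : V) : Set ℝ :=
  {l | eigProj M l u = -eigProj M l v ∧ eigProj M l v ≠ 0}

/-- The set `T = S ∪ R` for a vertex `u` of `X` and a graph on `n` vertices joined to `X`, where
`S = {l + n : l ∈ σ_u(L(X)), l ≠ 0}`, and `R = {0, m + n}` if `X` is connected,
`R = {0, m + n, n}` if not; here `m` is the number of vertices of `X`. -/
def shiftedSupport {V : Type*} [Fintype V] [DecidableEq V] (X : WGraph V) (n : ℕ) (u : V) :
    Set ℝ :=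
  {x | ∃ l ∈ eigSupport X.lap u, l ≠ 0 ∧ x = l + n} ∪ {0, (Fintype.card V : ℝ) + n} ∪
    {x | ¬ X.graph.Connected ∧ x = n}

/-- `g` is the greatest common divisor of the set `T`, which consists of integers: `g` divides
every element of `T`, and every common divisor divides `g`. -/
def IsGcdOf (g : ℕ) (T : Set ℝ) : Prop :=
  (∀ x ∈ T, ∃ k : ℤ, x = k * g) ∧ ∀ d : ℕ, (∀ x ∈ T, ∃ k : ℤ, x = k * d) → d ∣ g

/-- The 2-adic valuation; it is only applied to nonzero numbers. -/
def nu2 (q : ℚ) : ℤ := padicValRat 2 q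

/-- Here `P` stands for `σ⁺_{uv}(L(X)) ∪ {m}`, `N` for `σ⁻_{uv}(L(X))`, and `n` for the number of
vertices joined to `X`.  The integers `l` range over the nonzero elements of `P`. -/
def ValCondI (P N : Set ℝ) (n : ℕ) : Prop :=
  ∀ l a b : ℤ, l ≠ 0 → (l : ℝ) ∈ P → (a : ℝ) ∈ N → (b : ℝ) ∈ N →
    nu2 l > nu2 a ∧ nu2 a = nu2 b ∧ nu2 n > nu2 a

def ValCondII (P N : Set ℝ) (n : ℕ) : Prop :=
  ∀ l a : ℤ, l ≠ 0 → (l : ℝ) ∈ P → (a : ℝ) ∈ N →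
    nu2 a > nu2 l ∧ nu2 l = nu2 n

def ValCondIII (P N : Set ℝ) (n : ℕ) : Prop :=
  ∀ l a b : ℤ, l ≠ 0 → (l : ℝ) ∈ P → (a : ℝ) ∈ N → (b : ℝ) ∈ N →
    nu2 l = nu2 a ∧ nu2 a = nu2 n ∧
    nu2 ((l + n) / 2 ^ nu2 n) > nu2 ((a + n) / 2 ^ nu2 n) ∧
    nu2 ((a + n) / 2 ^ nu2 n) = nu2 ((b + n) / 2 ^ nu2 n)

end

/-!
Two facts turn perfect state transfer into arithmetic. For a real symmetric matrix `M` that kills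
the constant vectors, transfer from `v` to `u` at time `t` means `exp (i t M) e_v = e_u`: the matrix
is unitary, and the phase is one because the constants are fixed. Tested against the real
eigenvectors, which span, this says `exp (i t l) * y v = y u` for every eigenvector `y` with
eigenvalue `l` (`pstAt_iff`). In the join of `X` with a graph on `n` vertices, every eigenvector
restricts on `X` to a constant plus an eigenvector of `X` orthogonal to the constants, whose
eigenvalue `l` becomes `l + n`; the constants contribute the eigenvalues `0` and `m + n`
(`WGraph.pstAt_join_iff`).

As eigenvectors are real, each phase is `1` or `-1` wherever it matters. Hence transfer amounts to
strong cospectrality together with the alignment of phases: `1` on the frequencies `l + n` with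
`l` in `σ⁺` nonzero, on `m + n`, and on `n` if `X` is disconnected; `-1` on those with `l` in `σ⁻`
(`WGraph.pstAt_join_iff_phasesAlign`). The frequency `n` has a positive sign because `u` and `v`
lie in the same component, the only exception being `O_2` (`WGraph.reachable_of_pstAt_join`), where
the frequencies are `n + 2` and `n` with signs `1` and `-1`.

Alignment makes all quotients of frequencies rational, so the support of `u` consists of rational
algebraic integers. Integer frequencies align at some time exactly if those of negative sign share
one 2-adic valuation, smaller than those of the positive ones (`exists_phasesAlign_iff`); comparing
this valuation with that of `n` gives the three cases (`valuations_shift_iff`). At an aligning time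
`t`, the number `t g / π` is an odd integer, `g` being the greatest common divisor, so that `π / g`
aligns the phases too and is the first positive time to do so
(`exists_isGcdOf_isLeast_phasesAlign`).
-/

open Matrix

/-! ### Eigenvectors of real symmetric matrices -/

section Spectral

variable {V : Type*} [Fintype V] [DecidableEq V] {M : Matrix V V ℝ}

/-- The eigenvectors of a real symmetric matrix span: a linear map that vanishes on all of them
is zero. -/
lemma eq_zero_of_forall_eigenvector (hM : M.IsHermitian) {F : Type*} [AddCommGroup F] [Module ℝ F]
    (f : (V → ℝ) →ₗ[ℝ] F) (hf : ∀ (l : ℝ) (y : V → ℝ), M *ᵥ y = l • y → f y = 0) : f = 0 := by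
  refine LinearMap.ext fun y => ?_
  have h := hM.eigenvectorBasis.sum_repr (WithLp.toLp 2 y)
  have h2 : y = ∑ i, hM.eigenvectorBasis.repr (WithLp.toLp 2 y) i •
      (hM.eigenvectorBasis i).ofLp := by
    have := congrArg WithLp.ofLp h
    simpa using this.symm
  rw [h2, map_sum]
  refine (Finset.sum_eq_zero fun i _ => ?_)
  rw [map_smul, hf _ _ (hM.mulVec_eigenvectorBasis i), smul_zero]

lemma mem_eigenspace_toEuclideanLin {l : ℝ} {y : EuclideanSpace ℝ V} :
    y ∈ Module.End.eigenspace (Matrix.toEuclideanLin M) l ↔ M *ᵥ y.ofLp = l • y.ofLp := by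
  rw [Module.End.mem_eigenspace_iff]
  constructor
  · intro h
    exact congrArg WithLp.ofLp h
  · intro h
    ext i
    exact congrFun h i

/-- Linear relations between the projections of two coordinate vectors to an eigenspace are read
off the coordinates of the eigenvectors. -/
lemma eigProj_eq_smul_iff {l : ℝ} {u v : V} (c : ℝ) :
    eigProj M l u = c • eigProj M l v ↔ ∀ y : V → ℝ, M *ᵥ y = l • y → y u = c * y v := by
  rw [← sub_eq_zero, eigProj, eigProj, ← map_smul, ← map_sub,
    Submodule.starProjection_apply_eq_zero_iff, Submodule.mem_orthogonal]
  constructor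
  · intro h y hy
    have := h (WithLp.toLp 2 y) (mem_eigenspace_toEuclideanLin.2 hy)
    simp only [inner_sub_right, inner_smul_right, EuclideanSpace.inner_single_right] at this
    simpa [sub_eq_zero] using this
  · intro h y hy
    have := h y.ofLp (mem_eigenspace_toEuclideanLin.1 hy)
    simp only [inner_sub_right, inner_smul_right, EuclideanSpace.inner_single_right]
    simpa [sub_eq_zero] using this

lemma eigProj_eq_iff {l : ℝ} {u v : V} :
    eigProj M l u = eigProj M l v ↔ ∀ y : V → ℝ, M *ᵥ y = l • y → y u = y v := by
  simpa using eigProj_eq_smul_iff (M := M) (l := l) (u := u) (v := v) 1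

lemma eigProj_eq_neg_iff {l : ℝ} {u v : V} :
    eigProj M l u = -eigProj M l v ↔ ∀ y : V → ℝ, M *ᵥ y = l • y → y u = -y v := by
  simpa using eigProj_eq_smul_iff (M := M) (l := l) (u := u) (v := v) (-1)

lemma eigProj_ne_zero_iff {l : ℝ} {u : V} :
    eigProj M l u ≠ 0 ↔ ∃ y : V → ℝ, M *ᵥ y = l • y ∧ y u ≠ 0 := by
  have := eigProj_eq_smul_iff (M := M) (l := l) (u := u) (v := u) 0
  simp only [zero_smul, zero_mul] at this
  rw [Ne, this]
  push Not
  rfl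

/-- An element of an eigenvalue support is an eigenvalue, so it is a root of the characteristic
polynomial; if that polynomial has integer coefficients, a rational element is an integer. -/
lemma eigSupport_int_of_rat {u : V} {l : ℝ} (hl : l ∈ eigSupport M u)
    (hX : ∃ p : Polynomial ℤ, p.map (Int.castRingHom ℝ) = M.charpoly) {q : ℚ} (hq : l = q) :
    ∃ k : ℤ, l = k := by
  obtain ⟨p, hp⟩ := hX
  obtain ⟨y, hy, hyu⟩ := eigProj_ne_zero_iff.1 hl
  have hroot : M.charpoly.IsRoot l := by
    rw [Polynomial.IsRoot, Matrix.eval_charpoly, ← Matrix.exists_mulVec_eq_zero_iff]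
    refine ⟨y, fun h => hyu (congrFun h u), ?_⟩
    rw [Matrix.sub_mulVec, hy]
    ext i
    simp [Matrix.scalar_apply]
  have hmon : p.Monic := by
    refine Polynomial.monic_of_injective (Int.castRingHom ℝ).injective_int ?_
    rw [hp]
    exact Matrix.charpoly_monic M
  have hq0 : Polynomial.aeval q p = 0 := by
    have h1 : Polynomial.aeval (q : ℝ) p = 0 := by
      rw [Polynomial.aeval_def, ← Polynomial.eval_map]
      have : algebraMap ℤ ℝ = Int.castRingHom ℝ := rfl
      rw [this, hp, ← hq]
      exact hroot
    have h2 := Polynomial.aeval_algebraMap_apply ℝ q p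
    simp only [eq_ratCast] at h2
    rw [h1] at h2
    exact_mod_cast h2.symm
  obtain ⟨k, hk⟩ := isInteger_of_is_root_of_monic hmon hq0
  refine ⟨k, ?_⟩
  rw [hq, ← hk]
  simp

/-! ### The transition matrix -/

lemma exp_mulVec_of_eigenvector {A : Matrix V V ℂ} {z : ℂ} {y : V → ℂ} (h : A *ᵥ y = z • y) :
    NormedSpace.exp A *ᵥ y = Complex.exp z • y := by
  let _ : NormedRing (Matrix V V ℂ) := Matrix.linftyOpNormedRing
  let _ : NormedAlgebra ℂ (Matrix V V ℂ) := Matrix.linftyOpNormedAlgebra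
  have hpow : ∀ k : ℕ, A ^ k *ᵥ y = z ^ k • y := by
    intro k
    induction k with
    | zero => simp
    | succ k ih => rw [pow_succ, ← Matrix.mulVec_mulVec, h, Matrix.mulVec_smul, ih, smul_smul,
        pow_succ, mul_comm]
  have h1 : HasSum (fun k : ℕ => (k.factorial : ℂ)⁻¹ • A ^ k) (NormedSpace.exp A) :=
    NormedSpace.exp_series_hasSum_exp' A
  have h2 : HasSum (fun k : ℕ => (k.factorial : ℂ)⁻¹ • z ^ k) (Complex.exp z) := by
    rw [Complex.exp_eq_exp_ℂ]
    exact NormedSpace.exp_series_hasSum_exp' z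
  have h3 := h1.map (AddMonoidHom.mk' (fun B : Matrix V V ℂ => B *ᵥ y)
    (fun B C => Matrix.add_mulVec B C y)) (by
      change Continuous fun B : Matrix V V ℂ => B *ᵥ y
      exact Continuous.matrix_mulVec continuous_id continuous_const)
  have h4 := h2.smul_const y
  refine h3.unique ?_
  convert h4 using 1
  ext1 k
  simp [Matrix.smul_mulVec, hpow, smul_smul]

lemma transitionMatrix_mulVec {l : ℝ} {y : V → ℝ} (h : M *ᵥ y = l • y) (t : ℝ) :
    transitionMatrix M t *ᵥ (fun i => (y i : ℂ)) =
      Complex.exp (Complex.I * t * l) • fun i => (y i : ℂ) := by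
  refine exp_mulVec_of_eigenvector ?_
  rw [Matrix.smul_mulVec, mul_smul (Complex.I * t)]
  refine congrArg _ (funext fun i => ?_)
  have := congrFun h i
  simp only [Matrix.mulVec, dotProduct, Pi.smul_apply, smul_eq_mul, Matrix.map_apply] at this ⊢
  rw [← Complex.ofReal_mul, ← this]
  push_cast
  rfl

lemma transitionMatrix_isSymm (hM : M.IsHermitian) (t : ℝ) : (transitionMatrix M t).IsSymm := by
  refine Matrix.IsSymm.exp ?_
  ext i j
  have := hM.apply i j
  simp only [star_trivial] at this
  simp [this]

/-- Columns of the transition matrix are unit vectors, because the matrix is unitary. -/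
lemma sum_norm_sq_transitionMatrix (hM : M.IsHermitian) (t : ℝ) (v : V) :
    ∑ i, ‖transitionMatrix M t i v‖ ^ 2 = 1 := by
  have hct : ((Complex.I * (t : ℂ)) • M.map (fun x : ℝ => (x : ℂ)))ᴴ =
      -((Complex.I * (t : ℂ)) • M.map (fun x : ℝ => (x : ℂ))) := by
    ext i j
    have := hM.apply i j
    simp only [star_trivial] at this
    simp [this]
  have hU : (transitionMatrix M t)ᴴ * transitionMatrix M t = 1 := by
    rw [transitionMatrix, ← Matrix.exp_conjTranspose, hct, Matrix.exp_neg]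
    exact Matrix.nonsing_inv_mul _ ((Matrix.isUnit_iff_isUnit_det _).1 (Matrix.isUnit_exp _))
  have h := congrFun (congrFun hU v) v
  simp only [Matrix.mul_apply, Matrix.conjTranspose_apply, Matrix.one_apply_eq] at h
  have h2 : ∀ i, star (transitionMatrix M t i v) * transitionMatrix M t i v =
      ((‖transitionMatrix M t i v‖ ^ 2 : ℝ) : ℂ) := by
    intro i
    rw [Complex.star_def, Complex.conj_mul']
    push_cast
    rfl
  simp only [h2] at h
  exact_mod_cast h

/-- If the constant vectors lie in the kernel of `M`, then perfect state transfer means that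
`exp (i t M)` maps `e_v` to `e_u`, the phase being one; testing this against a real eigenvector
gives a condition on its two coordinates. -/
lemma pstAt_iff (hM : M.IsHermitian) (h1 : M *ᵥ (fun _ => 1) = 0) {u v : V} {t : ℝ} :
    PSTAt M u v t ↔ ∀ (l : ℝ) (y : V → ℝ), M *ᵥ y = l • y →
      Complex.exp (Complex.I * t * l) * y v = y u := by
  have hsym := transitionMatrix_isSymm hM t
  have htest : ∀ (l : ℝ) (y : V → ℝ), M *ᵥ y = l • y →
      ∑ i, transitionMatrix M t i v * y i = Complex.exp (Complex.I * t * l) * y v := by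
    intro l y hy
    have := congrFun (transitionMatrix_mulVec hy t) v
    simp only [Matrix.mulVec, dotProduct, Pi.smul_apply, smul_eq_mul] at this
    rw [← this]
    exact Finset.sum_congr rfl fun i _ => by rw [hsym.apply]
  constructor
  · intro h l y hy
    have hz : ∀ i, i ≠ u → transitionMatrix M t i v = 0 := by
      have hs := sum_norm_sq_transitionMatrix hM t v
      rw [← Finset.add_sum_erase _ _ (Finset.mem_univ u), h, one_pow, add_eq_left,
        Finset.sum_eq_zero_iff_of_nonneg (fun i _ => sq_nonneg _)] at hs
      intro i hi
      simpa using hs i (Finset.mem_erase.2 ⟨hi, Finset.mem_univ _⟩)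
    have hsum : ∀ y : V → ℝ, ∑ i, transitionMatrix M t i v * y i =
        transitionMatrix M t u v * y u := fun y =>
      Finset.sum_eq_single u (fun i _ hi => by rw [hz i hi, zero_mul]) (by simp)
    have hone : transitionMatrix M t u v = 1 := by
      have := htest 0 (fun _ => 1) (by rw [h1, zero_smul])
      rw [hsum] at this
      simpa using this
    rw [← htest l y hy, hsum, hone, one_mul]
  · intro h
    have hf := eq_zero_of_forall_eigenvector hM
      (∑ i, (LinearMap.proj i : (V → ℝ) →ₗ[ℝ] ℝ).smulRight (transitionMatrix M t i v) -
        (LinearMap.proj u : (V → ℝ) →ₗ[ℝ] ℝ).smulRight (1 : ℂ)) (by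
        intro l y hy
        have := (htest l y hy).trans (h l y hy)
        simpa [sub_eq_zero, mul_comm] using this)
    have := LinearMap.congr_fun hf (Pi.single u 1)
    have h2 : transitionMatrix M t u v = 1 := by
      simpa [sub_eq_zero, Pi.single_apply, apply_ite] using this
    rw [PSTAt, h2, norm_one]

end Spectral

/-! ### Laplacians of weighted graphs -/

namespace WGraph

section Laplacian

variable {V : Type*} [Fintype V] [DecidableEq V] (X : WGraph V)

lemma lap_mulVec_apply (y : V → ℝ) (x : V) :
    (X.lap *ᵥ y) x = ∑ z, X.w x z * (y x - y z) := by
  rw [lap, Matrix.sub_mulVec, Pi.sub_apply, Matrix.mulVec_diagonal, deg, Finset.sum_mul]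
  simp only [mul_sub, Finset.sum_sub_distrib]
  rfl

lemma lap_isHermitian : X.lap.IsHermitian := by
  refine Matrix.IsHermitian.sub (Matrix.isHermitian_diagonal _) ?_
  ext i j
  exact X.symm j i

lemma lap_mulVec_one : X.lap *ᵥ (fun _ => 1) = 0 := by
  ext x
  simp [lap_mulVec_apply]

lemma sum_lap_mulVec (y : V → ℝ) : ∑ x, (X.lap *ᵥ y) x = 0 := by
  have h : ∑ x, ∑ z, X.w x z * (y x - y z) = -∑ x, ∑ z, X.w x z * (y x - y z) := by
    conv_lhs => rw [Finset.sum_comm]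
    simp only [← Finset.sum_neg_distrib]
    refine Finset.sum_congr rfl fun x _ => Finset.sum_congr rfl fun z _ => ?_
    rw [X.symm z x]
    ring
  simp only [lap_mulVec_apply]
  linarith

lemma sum_eq_zero_of_eigenvector {l : ℝ} {y : V → ℝ} (h : X.lap *ᵥ y = l • y) (hl : l ≠ 0) :
    ∑ x, y x = 0 := by
  have := X.sum_lap_mulVec y
  rw [h] at this
  simp only [Pi.smul_apply, smul_eq_mul, ← Finset.mul_sum] at this
  exact (mul_eq_zero.1 this).resolve_left hl

lemma two_mul_dotProduct_lap_mulVec (y : V → ℝ) :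
    2 * ∑ x, y x * (X.lap *ᵥ y) x = ∑ x, ∑ z, X.w x z * (y x - y z) ^ 2 := by
  have h : ∑ x, y x * (X.lap *ᵥ y) x = ∑ x, ∑ z, y x * (X.w x z * (y x - y z)) := by
    simp only [lap_mulVec_apply, Finset.mul_sum]
  have h2 : ∑ x, y x * (X.lap *ᵥ y) x = ∑ x, ∑ z, y z * (X.w x z * (y z - y x)) := by
    rw [h, Finset.sum_comm]
    refine Finset.sum_congr rfl fun x _ => Finset.sum_congr rfl fun z _ => ?_
    rw [X.symm z x]
  rw [two_mul]
  nth_rw 1 [h]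
  rw [h2]
  simp only [← Finset.sum_add_distrib]
  refine Finset.sum_congr rfl fun x _ => Finset.sum_congr rfl fun z _ => ?_
  ring

lemma eigenvalue_nonneg {l : ℝ} {y : V → ℝ} (h : X.lap *ᵥ y = l • y) {u : V} (hu : y u ≠ 0) :
    0 ≤ l := by
  have h1 := X.two_mul_dotProduct_lap_mulVec y
  have h2 : 0 ≤ ∑ x, ∑ z, X.w x z * (y x - y z) ^ 2 :=
    Finset.sum_nonneg fun x _ => Finset.sum_nonneg fun z _ =>
      mul_nonneg (X.nonneg x z) (sq_nonneg _)
  have h3 : ∑ x, y x * (X.lap *ᵥ y) x = l * ∑ x, y x ^ 2 := by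
    rw [h, Finset.mul_sum]
    exact Finset.sum_congr rfl fun x _ => by simp only [Pi.smul_apply, smul_eq_mul]; ring
  have h4 : 0 < ∑ x, y x ^ 2 :=
    Finset.sum_pos' (fun x _ => sq_nonneg _) ⟨u, Finset.mem_univ _, by positivity⟩
  rw [h3] at h1
  by_contra! hl
  nlinarith

lemma eq_of_reachable {y : V → ℝ} (h : X.lap *ᵥ y = 0) {u v : V} (huv : X.graph.Reachable u v) :
    y u = y v := by
  have h1 := X.two_mul_dotProduct_lap_mulVec y
  simp only [h, Pi.zero_apply, mul_zero, Finset.sum_const_zero] at h1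
  have hnn : ∀ x z, 0 ≤ X.w x z * (y x - y z) ^ 2 := fun x z =>
    mul_nonneg (X.nonneg x z) (sq_nonneg _)
  have hadj : ∀ x z, X.graph.Adj x z → y x = y z := by
    intro x z hxz
    have h2 := (Finset.sum_eq_zero_iff_of_nonneg
      (fun x _ => Finset.sum_nonneg fun z _ => hnn x z)).1 h1.symm x (Finset.mem_univ _)
    have h3 := (Finset.sum_eq_zero_iff_of_nonneg (fun z _ => hnn x z)).1 h2 z (Finset.mem_univ _)
    have h4 := (mul_eq_zero.1 h3).resolve_left (ne_of_gt hxz)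
    exact sub_eq_zero.1 (pow_eq_zero_iff (two_ne_zero)|>.1 h4)
  obtain ⟨p⟩ := huv
  induction p with
  | nil => rfl
  | cons h _ ih => exact (hadj _ _ h).trans ih

open Classical in
/-- Restricting an eigenvector of the Laplacian to a connected component gives an eigenvector. -/
lemma lap_mulVec_restrict {l : ℝ} {y : V → ℝ} (h : X.lap *ᵥ y = l • y) (c : V) :
    X.lap *ᵥ (fun x => if X.graph.Reachable c x then y x else 0) =
      l • fun x => if X.graph.Reachable c x then y x else 0 := by
  ext x
  have hx := congrFun h x
  rw [lap_mulVec_apply] at hx ⊢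
  have hiff : ∀ z, X.w x z ≠ 0 → (X.graph.Reachable c x ↔ X.graph.Reachable c z) := by
    intro z hz
    have hadj : X.graph.Adj x z := lt_of_le_of_ne (X.nonneg x z) (Ne.symm hz)
    exact ⟨fun h => h.trans hadj.reachable, fun h => h.trans hadj.symm.reachable⟩
  simp only [Pi.smul_apply, smul_eq_mul] at hx ⊢
  split_ifs with hc
  · rw [← hx]
    refine Finset.sum_congr rfl fun z _ => ?_
    by_cases hz : X.w x z = 0
    · simp [hz]
    · rw [if_pos ((hiff z hz).1 hc)]
  · rw [mul_zero]
    refine Finset.sum_eq_zero fun z _ => ?_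
    by_cases hz : X.w x z = 0
    · simp [hz]
    · rw [if_neg (fun hr => hc ((hiff z hz).2 hr)), sub_zero, mul_zero]

/-- If not every vertex is reachable from `c`, then the kernel of the Laplacian contains a vector
orthogonal to the constants that does not vanish on the component of `c`: the indicator vector of
the component, corrected by its mean `s < 1`. -/
lemma exists_component_vector [Nonempty V] {c : V} (hc : ∃ x, ¬ X.graph.Reachable c x) :
    ∃ y : V → ℝ, X.lap *ᵥ y = 0 ∧ ∑ x, y x = 0 ∧
      ∃ s : ℝ, s < 1 ∧ ∀ x, X.graph.Reachable c x → y x = 1 - s := by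
  classical
  have h1 : X.lap *ᵥ (fun _ => (1 : ℝ)) = (0 : ℝ) • fun _ => (1 : ℝ) := by
    rw [lap_mulVec_one, zero_smul]
  have h2 := X.lap_mulVec_restrict h1 c
  rw [zero_smul] at h2
  set m := (Fintype.card V : ℝ) with hm
  have hmpos : 0 < m := by
    rw [hm]
    exact_mod_cast Fintype.card_pos
  set k : ℝ := ∑ x, if X.graph.Reachable c x then (1 : ℝ) else 0 with hk
  refine ⟨(fun x => if X.graph.Reachable c x then (1 : ℝ) else 0) - (k / m) • fun _ => (1 : ℝ),
    ?_, ?_, k / m, ?_, ?_⟩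
  · rw [Matrix.mulVec_sub, Matrix.mulVec_smul, h2, lap_mulVec_one, smul_zero, sub_zero]
  · simp only [Pi.sub_apply, Pi.smul_apply, smul_eq_mul, mul_one, Finset.sum_sub_distrib,
      Finset.sum_const, Finset.card_univ, nsmul_eq_mul]
    rw [← hk, ← hm]
    field_simp
    ring
  · obtain ⟨x, hx⟩ := hc
    rw [div_lt_one hmpos]
    have hm' : m = ∑ _x : V, (1 : ℝ) := by simp [hm]
    rw [hk, hm']
    refine Finset.sum_lt_sum (fun z _ => by split_ifs <;> norm_num) ⟨x, Finset.mem_univ _, ?_⟩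
    rw [if_neg hx]
    norm_num
  · intro x hx
    simp [hx]

lemma zero_notMem_sigmaMinus {u v : V} : (0 : ℝ) ∉ sigmaMinus X.lap u v := by
  rintro ⟨h, -⟩
  have := eigProj_eq_neg_iff.1 h (fun _ => 1) (by rw [lap_mulVec_one, zero_smul])
  norm_num at this

end Laplacian

/-! ### State transfer in a join -/

section Join

variable {V W : Type*} [Fintype V] [DecidableEq V] [Fintype W] [DecidableEq W]
  (X : WGraph V) (Y : WGraph W)

lemma join_lap_mulVec_inl (y : V ⊕ W → ℝ) (x : V) :
    ((X.join Y).lap *ᵥ y) (Sum.inl x) = (X.lap *ᵥ (y ∘ Sum.inl)) x +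
      (Fintype.card W * y (Sum.inl x) - ∑ z, y (Sum.inr z)) := by
  rw [lap_mulVec_apply, lap_mulVec_apply, Fintype.sum_sum_type]
  simp [join, joinWeight]

lemma join_lap_mulVec_inr (y : V ⊕ W → ℝ) (x : W) :
    ((X.join Y).lap *ᵥ y) (Sum.inr x) = (Y.lap *ᵥ (y ∘ Sum.inr)) x +
      (Fintype.card V * y (Sum.inr x) - ∑ z, y (Sum.inl z)) := by
  rw [lap_mulVec_apply, lap_mulVec_apply, Fintype.sum_sum_type]
  simp [join, joinWeight, add_comm]

/-- Eigenvectors of `X ∨ Y`: for an eigenvector `y` of `X` orthogonal to the constants, `(y, 0)` is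
one with eigenvalue `l + n`; and there is one, constant on each side, for `m + n`.  The components
in `X` of all eigenvectors are combinations of these and of constant vectors. -/
lemma pstAt_join_iff [Nonempty V] [Nonempty W] {u v : V} {t : ℝ} :
    PSTAt (X.join Y).lap (Sum.inl u) (Sum.inl v) t ↔
      Complex.exp (Complex.I * t * (Fintype.card V + Fintype.card W : ℝ)) = 1 ∧
      ∀ (l : ℝ) (y : V → ℝ), X.lap *ᵥ y = l • y → ∑ x, y x = 0 →
        Complex.exp (Complex.I * t * (l + Fintype.card W : ℝ)) * y v = y u := by
  have hm : (0 : ℝ) < Fintype.card V := by exact_mod_cast Fintype.card_pos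
  have hn : (0 : ℝ) < Fintype.card W := by exact_mod_cast Fintype.card_pos
  rw [pstAt_iff (X.join Y).lap_isHermitian (X.join Y).lap_mulVec_one]
  constructor
  · intro h
    constructor
    · have := h (Fintype.card V + Fintype.card W)
        (Sum.elim (fun _ => (Fintype.card W : ℝ)) (fun _ => -(Fintype.card V : ℝ))) (by
          funext x
          rcases x with x | x
          · rw [join_lap_mulVec_inl, lap_mulVec_apply]
            simp
            ring
          · rw [join_lap_mulVec_inr, lap_mulVec_apply]
            simp
            ring)
      have hn' : ((Fintype.card W : ℝ) : ℂ) ≠ 0 := by exact_mod_cast hn.ne'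
      simpa only [Sum.elim_inl, mul_eq_right₀ hn'] using this
    · intro l y hy hs
      refine h (l + Fintype.card W) (Sum.elim y (fun _ => 0)) ?_
      funext x
      rcases x with x | x
      · rw [join_lap_mulVec_inl, Sum.elim_comp_inl, hy]
        simp
        ring
      · rw [join_lap_mulVec_inr, lap_mulVec_apply]
        simp [hs]
  · rintro ⟨h1, h2⟩ θ y hy
    set s : ℝ := ∑ x, y (Sum.inl x) with hs
    set r : ℝ := ∑ x, y (Sum.inr x) with hr
    have hl : ∀ x, (X.lap *ᵥ (y ∘ Sum.inl)) x = θ * y (Sum.inl x) -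
        (Fintype.card W * y (Sum.inl x) - r) := fun x => by
      rw [eq_sub_iff_add_eq, ← join_lap_mulVec_inl, hy]
      rfl
    have hrr : ∀ x, (Y.lap *ᵥ (y ∘ Sum.inr)) x = θ * y (Sum.inr x) -
        (Fintype.card V * y (Sum.inr x) - s) := fun x => by
      rw [eq_sub_iff_add_eq, ← join_lap_mulVec_inr, hy]
      rfl
    have e1 : θ * s = Fintype.card W * s - Fintype.card V * r := by
      have := X.sum_lap_mulVec (y ∘ Sum.inl)
      simp only [hl, Finset.sum_sub_distrib, ← Finset.mul_sum, Finset.sum_const,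
        Finset.card_univ, nsmul_eq_mul, ← hs] at this
      linarith
    have e2 : θ * r = Fintype.card V * r - Fintype.card W * s := by
      have := Y.sum_lap_mulVec (y ∘ Sum.inr)
      simp only [hrr, Finset.sum_sub_distrib, ← Finset.mul_sum, Finset.sum_const,
        Finset.card_univ, nsmul_eq_mul, ← hr] at this
      linarith
    -- the part of `y` on `X` is a constant plus an eigenvector orthogonal to the constants
    have key := h2 (θ - Fintype.card W) (fun x => y (Sum.inl x) - s / Fintype.card V) (by
      have : (fun x => y (Sum.inl x) - s / Fintype.card V) =
          (y ∘ Sum.inl) - (s / Fintype.card V) • fun _ => (1 : ℝ) := by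
        ext x
        simp
      rw [this, Matrix.mulVec_sub, Matrix.mulVec_smul, lap_mulVec_one, smul_zero, sub_zero]
      ext x
      rw [hl]
      simp only [Pi.smul_apply, Pi.sub_apply, smul_eq_mul, Function.comp_apply]
      field_simp
      linarith) (by
      simp only [Finset.sum_sub_distrib, Finset.sum_const, Finset.card_univ, nsmul_eq_mul, ← hs]
      field_simp
      ring)
    -- the constant occurs only for the eigenvalues `0` and `m + n`
    have hmean : Complex.exp (Complex.I * t * θ) * ((s / Fintype.card V : ℝ) : ℂ) =
        ((s / Fintype.card V : ℝ) : ℂ) := by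
      have h3 : θ * (s + r) = 0 := by linarith
      rcases mul_eq_zero.1 h3 with h3 | h3
      · simp [h3]
      · have h4 : (θ - (Fintype.card V + Fintype.card W)) * s = 0 := by
          have : r = -s := by linarith
          rw [this] at e1
          linarith
        rcases mul_eq_zero.1 h4 with h4 | h4
        · rw [sub_eq_zero.1 h4, h1, one_mul]
        · simp [h4]
    rw [sub_add_cancel] at key
    push_cast at key hmean ⊢
    linear_combination key + hmean

end Join

end WGraph

/-! ### Phases and 2-adic valuations -/

lemma exp_I_mul_eq_one_iff {t x : ℝ} :
    Complex.exp (Complex.I * t * x) = 1 ↔ ∃ k : ℤ, t * x = 2 * k * Real.pi := by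
  rw [Complex.exp_eq_one_iff]
  refine exists_congr fun k => ?_
  have h : Complex.I * t * x = Complex.I * ((t * x : ℝ) : ℂ) := by push_cast; ring
  have h2 : (k : ℂ) * (2 * Real.pi * Complex.I) = Complex.I * ((2 * k * Real.pi : ℝ) : ℂ) := by
    push_cast; ring
  rw [h, h2, mul_right_inj' Complex.I_ne_zero, Complex.ofReal_inj]

lemma exp_I_mul_eq_neg_one_iff {t x : ℝ} :
    Complex.exp (Complex.I * t * x) = -1 ↔ ∃ k : ℤ, t * x = (2 * k + 1) * Real.pi := by
  rw [← Complex.exp_pi_mul_I, Complex.exp_eq_exp_iff_exists_int]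
  refine exists_congr fun k => ?_
  have h : Complex.I * t * x = Complex.I * ((t * x : ℝ) : ℂ) := by push_cast; ring
  have h2 : (Real.pi : ℂ) * Complex.I + (k : ℂ) * (2 * Real.pi * Complex.I) =
      Complex.I * (((2 * k + 1) * Real.pi : ℝ) : ℂ) := by
    push_cast; ring
  rw [h, h2, mul_right_inj' Complex.I_ne_zero, Complex.ofReal_inj]

lemma norm_exp_I_mul (t x : ℝ) : ‖Complex.exp (Complex.I * t * x)‖ = 1 := by
  have : Complex.I * t * x = ((t * x : ℝ) : ℂ) * Complex.I := by push_cast; ring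
  rw [this, Complex.norm_exp_ofReal_mul_I]

/-- At time `t` the frequencies in `Tp` have phase `1` and those in `Tm` have phase `-1`. -/
def PhasesAlign (Tp Tm : Set ℝ) (t : ℝ) : Prop :=
  (∀ x ∈ Tp, Complex.exp (Complex.I * t * x) = 1) ∧
    ∀ x ∈ Tm, Complex.exp (Complex.I * t * x) = -1

/-- If the phases of a set of integer frequencies align at some time, they first do so at `π / g`,
with `g` the greatest common divisor: at an aligning time `t`, the number `t g / π` is an integer,
and odd because `Tm` is not empty, so `x / g` has the parity of `t x / π` for each frequency. -/
lemma exists_isGcdOf_isLeast_phasesAlign {Tp Tm : Set ℝ} (hp : ∀ x ∈ Tp, ∃ k : ℤ, x = k)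
    (hm : ∀ x ∈ Tm, ∃ k : ℤ, x = k) (hne : Tm.Nonempty) (ht : ∃ t, PhasesAlign Tp Tm t) :
    ∃ g : ℕ, IsGcdOf g (insert 0 (Tp ∪ Tm)) ∧
      IsLeast {t : ℝ | 0 < t ∧ PhasesAlign Tp Tm t} (Real.pi / g) := by
  set S : Set ℤ := {k | (k : ℝ) ∈ Tp ∪ Tm} with hS
  set I : Ideal ℤ := Ideal.span S with hI
  have hpi := Real.pi_pos
  obtain ⟨a, ha⟩ := IsPrincipalIdealRing.principal I
  set g : ℕ := a.natAbs with hg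
  have hgI : (g : ℤ) ∈ I := by
    rw [ha, hg]
    exact Submodule.mem_span_singleton.2 (by
      rcases Int.natAbs_eq a with h | h
      · exact ⟨1, by rw [one_smul]; exact h⟩
      · exact ⟨-1, by rw [neg_one_smul]; omega⟩)
  have hgdvd : ∀ x ∈ Tp ∪ Tm, ∃ q : ℤ, x = q * g := by
    intro x hx
    have : ∃ k : ℤ, x = k := hx.elim (hp x) (hm x)
    obtain ⟨k, rfl⟩ := this
    have hk : k ∈ I := Ideal.subset_span hx
    rw [ha, Ideal.submodule_span_eq, Ideal.mem_span_singleton, ← Int.natAbs_dvd] at hk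
    obtain ⟨q, hq⟩ := hk
    refine ⟨q, ?_⟩
    rw [hq, ← hg]
    push_cast
    ring
  have hint : ∀ t, PhasesAlign Tp Tm t → ∃ j : ℤ, t * g = j * Real.pi := by
    intro t ht
    have : ∀ k ∈ I, ∃ j : ℤ, t * (k : ℝ) = j * Real.pi := by
      intro k hk
      induction hk using Submodule.span_induction with
      | mem k hk =>
        rcases hk with hk | hk
        · obtain ⟨j, hj⟩ := exp_I_mul_eq_one_iff.1 (ht.1 _ hk)
          exact ⟨2 * j, by rw [hj]; push_cast; ring⟩
        · obtain ⟨j, hj⟩ := exp_I_mul_eq_neg_one_iff.1 (ht.2 _ hk)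
          exact ⟨2 * j + 1, by rw [hj]; push_cast; ring⟩
      | zero => exact ⟨0, by simp⟩
      | add k l _ _ hk hl =>
        obtain ⟨i, hi⟩ := hk
        obtain ⟨j, hj⟩ := hl
        exact ⟨i + j, by push_cast; rw [mul_add, hi, hj]; ring⟩
      | smul c k _ hk =>
        obtain ⟨i, hi⟩ := hk
        exact ⟨c * i, by rw [smul_eq_mul]; push_cast; rw [mul_assoc, ← hi]; ring⟩
    simpa using this g hgI
  obtain ⟨t, ht⟩ := ht
  obtain ⟨j, hj⟩ := hint t ht
  -- comparison of `t x / π` with `q = x / g`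
  have hq : ∀ (q c : ℤ), t * ((q : ℝ) * g) = c * Real.pi → c = j * q := by
    intro q c h
    have h2 : (c : ℝ) * Real.pi = (j * q : ℝ) * Real.pi := by
      rw [← h, mul_left_comm, hj]
      ring
    exact_mod_cast mul_right_cancel₀ hpi.ne' h2
  have hqm : ∀ q : ℤ, (q : ℝ) * g ∈ Tm → ¬ Even (j * q) := by
    intro q hx
    obtain ⟨c, hc⟩ := exp_I_mul_eq_neg_one_iff.1 (ht.2 _ hx)
    rw [← hq q (2 * c + 1) (by rw [hc]; push_cast; ring)]
    simp [parity_simps]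
  obtain ⟨x₀, hx₀⟩ := hne
  obtain ⟨q₀, hq₀⟩ := hgdvd x₀ (Or.inr hx₀)
  have hj2 : ¬ Even j := fun h => hqm q₀ (hq₀ ▸ hx₀) (h.mul_right _)
  have hg0 : 0 < (g : ℝ) := by
    refine lt_of_le_of_ne (Nat.cast_nonneg _) fun h => hj2 ?_
    rw [← h, mul_zero] at hj
    have : (j : ℝ) = 0 := (mul_eq_zero.1 hj.symm).resolve_right hpi.ne'
    rw [Int.cast_eq_zero.1 this]
    exact Even.zero
  refine ⟨g, ⟨?_, ?_⟩, ⟨div_pos hpi hg0, ?_, ?_⟩, ?_⟩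
  · rintro x (rfl | hx)
    · exact ⟨0, by simp⟩
    · exact hgdvd x hx
  · intro d hd
    have hle : I ≤ Ideal.span {(d : ℤ)} := by
      refine Ideal.span_le.2 fun k hk => ?_
      obtain ⟨c, hc⟩ := hd k (Or.inr hk)
      refine Ideal.mem_span_singleton.2 ⟨c, ?_⟩
      rw [mul_comm]
      exact_mod_cast hc
    exact Int.natCast_dvd_natCast.1 (Ideal.mem_span_singleton.1 (hle hgI))
  · intro x hx
    obtain ⟨q, rfl⟩ := hgdvd x (Or.inl hx)
    obtain ⟨c, hc⟩ := exp_I_mul_eq_one_iff.1 (ht.1 _ hx)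
    have h := hq q (2 * c) (by rw [hc]; push_cast; ring)
    have hev : Even (j * q) := h ▸ even_two_mul c
    obtain ⟨k, rfl⟩ := ((Int.even_mul.1 hev).resolve_left hj2).two_dvd
    refine exp_I_mul_eq_one_iff.2 ⟨k, ?_⟩
    field_simp
    push_cast
    ring
  · intro x hx
    obtain ⟨q, rfl⟩ := hgdvd x (Or.inr hx)
    have h := hqm q hx
    obtain ⟨k, rfl⟩ := Int.not_even_iff_odd.1 (fun hev => h (Even.mul_left hev j))
    refine exp_I_mul_eq_neg_one_iff.2 ⟨k, ?_⟩
    field_simp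
    push_cast
    ring
  · rintro s ⟨hs0, hs⟩
    obtain ⟨i, hi⟩ := hint s hs
    have h1 : 0 < (i : ℝ) := by
      have : 0 < (i : ℝ) * Real.pi := hi ▸ mul_pos hs0 hg0
      exact pos_of_mul_pos_left this hpi.le
    have h2 : (1 : ℝ) ≤ i := by exact_mod_cast (Int.cast_pos.1 h1 : 0 < i)
    rw [div_le_iff₀ hg0, hi]
    exact le_mul_of_one_le_left hpi.le h2

lemma nu2_mul {a b : ℚ} (ha : a ≠ 0) (hb : b ≠ 0) : nu2 (a * b) = nu2 a + nu2 b :=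
  padicValRat.mul ha hb

lemma nu2_two : nu2 2 = 1 := by
  simpa [nu2] using padicValRat.self (p := 2) one_lt_two

lemma nu2_odd (q : ℤ) : nu2 (2 * q + 1 : ℤ) = 0 := by
  rw [nu2, padicValRat.of_int, padicValInt.eq_zero_of_not_dvd (by omega)]
  rfl

lemma nu2_int_nonneg (z : ℤ) : 0 ≤ nu2 z := by
  rw [nu2, padicValRat.of_int]
  positivity

lemma exists_eq_two_pow_mul_odd {z : ℤ} (hz : z ≠ 0) :
    ∃ (k : ℕ) (q : ℤ), z = 2 ^ k * (2 * q + 1) ∧ nu2 z = k := by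
  have hfin : FiniteMultiplicity 2 z := Int.finiteMultiplicity_iff.2 ⟨by norm_num, hz⟩
  obtain ⟨c, h, hc⟩ := hfin.exists_eq_pow_mul_and_not_dvd
  generalize multiplicity 2 z = k at h
  obtain ⟨q, rfl⟩ : ∃ q, c = 2 * q + 1 := ⟨c / 2, by omega⟩
  refine ⟨k, q, h, ?_⟩
  have hq : ((2 * q + 1 : ℤ) : ℚ) ≠ 0 := Int.cast_ne_zero.2 (by omega)
  rw [h, Int.cast_mul, nu2_mul (by positivity) hq, nu2_odd, Int.cast_pow, Int.cast_ofNat, nu2,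
    padicValRat.pow, show padicValRat 2 2 = 1 from nu2_two]
  ring

/-- Nonzero integer frequencies align at some time precisely if the valuations of those in `Tm`
agree and are smaller than the valuations of those in `Tp`; a suitable time is then `π / 2 ^ k`,
where `k` is the common valuation. -/
lemma exists_phasesAlign_iff {Tp Tm : Set ℝ} (hp : ∀ x ∈ Tp, ∃ k : ℤ, x = k)
    (hm : ∀ x ∈ Tm, ∃ k : ℤ, x = k) (hp0 : (0 : ℝ) ∉ Tp) (hm0 : (0 : ℝ) ∉ Tm) (hpne : Tp.Nonempty)
    (hne : Tm.Nonempty) :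
    (∃ t, PhasesAlign Tp Tm t) ↔ ∀ x a b : ℤ, (x : ℝ) ∈ Tp → (a : ℝ) ∈ Tm → (b : ℝ) ∈ Tm →
      nu2 a < nu2 x ∧ nu2 a = nu2 b := by
  have hpi := Real.pi_pos
  have hcast : ∀ (S : Set ℝ) (z : ℤ), (0 : ℝ) ∉ S → (z : ℝ) ∈ S → z ≠ 0 := by
    rintro S z hS hz rfl
    exact hS (by simpa using hz)
  constructor
  · rintro ⟨t, ht⟩ x a b hx ha hb
    obtain ⟨j, hj⟩ := exp_I_mul_eq_one_iff.1 (ht.1 _ hx)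
    obtain ⟨k, hk⟩ := exp_I_mul_eq_neg_one_iff.1 (ht.2 _ ha)
    obtain ⟨l, hl⟩ := exp_I_mul_eq_neg_one_iff.1 (ht.2 _ hb)
    have hx0 := hcast _ _ hp0 hx
    have ha0 := hcast _ _ hm0 ha
    have hb0 := hcast _ _ hm0 hb
    have e1 : (2 * k + 1) * x = 2 * j * a := by
      have : ((2 * k + 1 : ℝ) * x) * Real.pi = (2 * j * a : ℝ) * Real.pi := by
        linear_combination (-x : ℝ) * hk + a * hj
      exact_mod_cast mul_right_cancel₀ hpi.ne' this
    have e2 : (2 * k + 1) * b = (2 * l + 1) * a := by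
      have : ((2 * k + 1 : ℝ) * b) * Real.pi = ((2 * l + 1) * a : ℝ) * Real.pi := by
        linear_combination (-b : ℝ) * hk + a * hl
      exact_mod_cast mul_right_cancel₀ hpi.ne' this
    have hj0 : j ≠ 0 := by
      rintro rfl
      rw [mul_zero, zero_mul] at e1
      rcases mul_eq_zero.1 e1 with h | h
      · omega
      · exact hx0 h
    have hval : ∀ c d : ℤ, c ≠ 0 → d ≠ 0 → nu2 (c * d : ℤ) = nu2 c + nu2 d := by
      intro c d hc hd
      push_cast
      exact nu2_mul (by exact_mod_cast hc) (by exact_mod_cast hd)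
    have v1 := congrArg (fun z : ℤ => nu2 z) e1
    have v2 := congrArg (fun z : ℤ => nu2 z) e2
    rw [hval _ _ (by omega) hx0, hval _ _ (by omega) ha0, hval _ _ (by omega) hj0, nu2_odd] at v1
    rw [hval _ _ (by omega) hb0, hval _ _ (by omega) ha0, nu2_odd, nu2_odd] at v2
    have h2 : nu2 (2 : ℤ) = 1 := nu2_two
    have hjn := nu2_int_nonneg j
    rw [h2] at v1
    omega
  · intro h
    obtain ⟨x₀, hx₀⟩ := hpne
    obtain ⟨k₀, rfl⟩ := hp x₀ hx₀
    obtain ⟨a₀, ha₀⟩ := hne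
    obtain ⟨a, rfl⟩ := hm a₀ ha₀
    obtain ⟨k, q, haq, hak⟩ := exists_eq_two_pow_mul_odd (hcast _ _ hm0 ha₀)
    refine ⟨Real.pi / 2 ^ k, fun x hx => ?_, fun x hx => ?_⟩
    · obtain ⟨z, rfl⟩ := hp x hx
      obtain ⟨i, p, hz, hzi⟩ := exists_eq_two_pow_mul_odd (hcast _ _ hp0 hx)
      have hlt := (h z a a hx ha₀ ha₀).1
      obtain ⟨d, rfl⟩ : ∃ d, i = k + d + 1 := ⟨i - k - 1, by omega⟩
      refine exp_I_mul_eq_one_iff.2 ⟨2 ^ d * (2 * p + 1), ?_⟩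
      rw [hz]
      push_cast
      field_simp
      ring
    · obtain ⟨z, rfl⟩ := hm x hx
      obtain ⟨i, p, hz, hzi⟩ := exists_eq_two_pow_mul_odd (hcast _ _ hm0 hx)
      have heq := (h k₀ a z hx₀ ha₀ hx).2
      obtain rfl : i = k := by omega
      refine exp_I_mul_eq_neg_one_iff.2 ⟨p, ?_⟩
      rw [hz]
      push_cast
      field_simp

lemma nu2_add_of_lt {a b : ℤ} (ha : a ≠ 0) (hb : b ≠ 0) (hab : a + b ≠ 0) (h : nu2 a < nu2 b) :
    nu2 (a + b : ℤ) = nu2 a := by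
  push_cast
  exact padicValRat.add_eq_of_lt (by exact_mod_cast hab) (by exact_mod_cast ha)
    (by exact_mod_cast hb) h

/-- The sum of two odd numbers is even. -/
lemma lt_nu2_add_of_eq {a b : ℤ} (ha : a ≠ 0) (hb : b ≠ 0) (hab : a + b ≠ 0)
    (h : nu2 a = nu2 b) : nu2 b < nu2 (a + b : ℤ) := by
  obtain ⟨k, q, hq, hk⟩ := exists_eq_two_pow_mul_odd ha
  obtain ⟨l, p, hp, hl⟩ := exists_eq_two_pow_mul_odd hb
  obtain rfl : k = l := by omega
  have hsum : a + b = 2 ^ k * (2 * (q + p + 1)) := by rw [hq, hp]; ring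
  have hne : q + p + 1 ≠ 0 := by
    intro h0
    rw [h0] at hsum
    exact hab (by simpa using hsum)
  have h2 : nu2 ((2 * (q + p + 1) : ℤ) : ℚ) = 1 + nu2 (q + p + 1 : ℤ) := by
    rw [Int.cast_mul, nu2_mul (by norm_num) (Int.cast_ne_zero.2 hne), Int.cast_ofNat, nu2_two]
  have h3 : nu2 ((2 : ℚ) ^ k) = k := by
    rw [nu2, padicValRat.pow, show padicValRat 2 2 = 1 from nu2_two, mul_one]
  have h4 : nu2 (a + b : ℤ) = k + (1 + nu2 (q + p + 1 : ℤ)) := by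
    rw [← h3, ← h2, hsum, Int.cast_mul, nu2_mul (by positivity)
      (Int.cast_ne_zero.2 (mul_ne_zero two_ne_zero hne)), Int.cast_pow, Int.cast_ofNat]
  have := nu2_int_nonneg (q + p + 1)
  omega

lemma nu2_div_two_zpow {a : ℤ} (ha : a ≠ 0) (k : ℤ) : nu2 ((a : ℚ) / 2 ^ k) = nu2 a - k := by
  rw [nu2, padicValRat.div (by exact_mod_cast ha) (by positivity), padicValRat.zpow,
    show padicValRat 2 2 = 1 from nu2_two, mul_one]
  rfl

/-- The valuation of `a + n`, by comparison of the valuations of `a` and `n`. -/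
lemma nu2_add_natCast_cases {n : ℕ} (hn : n ≠ 0) {a : ℤ} (ha : 0 < a) :
    (nu2 a < nu2 n ∧ nu2 (a + n : ℤ) = nu2 a) ∨ (nu2 n < nu2 a ∧ nu2 (a + n : ℤ) = nu2 n) ∨
      (nu2 a = nu2 n ∧ nu2 n < nu2 (a + n : ℤ)) := by
  have hcast : nu2 (n : ℚ) = nu2 ((n : ℤ) : ℚ) := by simp
  have hn' : (n : ℤ) ≠ 0 := by omega
  rw [hcast]
  rcases lt_trichotomy (nu2 a) (nu2 (n : ℤ)) with h | h | h
  · exact Or.inl ⟨h, nu2_add_of_lt ha.ne' hn' (by omega) h⟩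
  · exact Or.inr (Or.inr ⟨h, lt_nu2_add_of_eq ha.ne' hn' (by omega) h⟩)
  · refine Or.inr (Or.inl ⟨h, ?_⟩)
    rw [add_comm]
    exact nu2_add_of_lt hn' ha.ne' (by omega) h

section Valuations

variable {P N : Set ℝ} {n : ℕ}

/-- The three conditions correspond to the three ways in which the valuation of one, hence of each,
element of `N` may compare with that of `n`. -/
lemma valuations_shift_iff (hn : n ≠ 0) (hP : ∀ l : ℤ, (l : ℝ) ∈ P → 0 ≤ l)
    (hN : ∀ a : ℤ, (a : ℝ) ∈ N → 0 < a) (hPne : ∃ l : ℤ, l ≠ 0 ∧ (l : ℝ) ∈ P)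
    (hNne : ∃ a : ℤ, (a : ℝ) ∈ N) :
    (∀ l a b : ℤ, l ≠ 0 → (l : ℝ) ∈ P → (a : ℝ) ∈ N → (b : ℝ) ∈ N →
      nu2 (a + n : ℤ) < nu2 (l + n : ℤ) ∧ nu2 (a + n : ℤ) = nu2 (b + n : ℤ)) ↔
    ValCondI P N n ∨ ValCondII P N n ∨ ValCondIII P N n := by
  have hdiv : ∀ a : ℤ, 0 < a →
      nu2 (((a : ℚ) + n) / 2 ^ nu2 n) = nu2 (a + n : ℤ) - nu2 n := by
    intro a ha
    rw [← nu2_div_two_zpow (by omega : a + n ≠ 0)]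
    push_cast
    rfl
  have hPpos : ∀ l : ℤ, l ≠ 0 → (l : ℝ) ∈ P → 0 < l := fun l hl h =>
    lt_of_le_of_ne (hP l h) hl.symm
  constructor
  · intro h
    obtain ⟨a₀, ha₀⟩ := hNne
    obtain ⟨l₀, hl₀, hlP⟩ := hPne
    rcases nu2_add_natCast_cases hn (hN a₀ ha₀) with h0 | h0 | h0
    · refine Or.inl fun l a b hl hlP ha hb => ?_
      have h1 := h l a₀ a hl hlP ha₀ ha
      have h2 := h l a₀ b hl hlP ha₀ hb
      rcases nu2_add_natCast_cases hn (hN a ha) with h3 | h3 | h3 <;>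
      rcases nu2_add_natCast_cases hn (hN b hb) with h4 | h4 | h4 <;>
      rcases nu2_add_natCast_cases hn (hPpos l hl hlP) with h5 | h5 | h5 <;> omega
    · refine Or.inr (Or.inl fun l a hl hlP ha => ?_)
      have h1 := h l a₀ a hl hlP ha₀ ha
      rcases nu2_add_natCast_cases hn (hN a ha) with h3 | h3 | h3 <;>
      rcases nu2_add_natCast_cases hn (hPpos l hl hlP) with h5 | h5 | h5 <;> omega
    · refine Or.inr (Or.inr fun l a b hl hlP ha hb => ?_)
      have h1 := h l a₀ a hl hlP ha₀ ha
      have h2 := h l a₀ b hl hlP ha₀ hb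
      rw [hdiv l (hPpos l hl hlP), hdiv a (hN a ha), hdiv b (hN b hb)]
      rcases nu2_add_natCast_cases hn (hN a ha) with h3 | h3 | h3 <;>
      rcases nu2_add_natCast_cases hn (hN b hb) with h4 | h4 | h4 <;>
      rcases nu2_add_natCast_cases hn (hPpos l hl hlP) with h5 | h5 | h5 <;> omega
  · intro h l a b hl hlP ha hb
    have h3 := nu2_add_natCast_cases hn (hN a ha)
    have h4 := nu2_add_natCast_cases hn (hN b hb)
    have h5 := nu2_add_natCast_cases hn (hPpos l hl hlP)
    rcases h with h | h | h
    · have := h l a b hl hlP ha hb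
      omega
    · have h1 := h l a hl hlP ha
      have h2 := h l b hl hlP hb
      omega
    · have := h l a b hl hlP ha hb
      rw [hdiv l (hPpos l hl hlP), hdiv a (hN a ha), hdiv b (hN b hb)] at this
      omega

/-- If `n` itself has to have larger valuation than the `a + n`, only the first of the three
conditions remains. -/
lemma valuations_shift_and_iff (hn : n ≠ 0) (hP : ∀ l : ℤ, (l : ℝ) ∈ P → 0 ≤ l)
    (hN : ∀ a : ℤ, (a : ℝ) ∈ N → 0 < a) (hPne : ∃ l : ℤ, l ≠ 0 ∧ (l : ℝ) ∈ P) :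
    ((∀ l a b : ℤ, l ≠ 0 → (l : ℝ) ∈ P → (a : ℝ) ∈ N → (b : ℝ) ∈ N →
      nu2 (a + n : ℤ) < nu2 (l + n : ℤ) ∧ nu2 (a + n : ℤ) = nu2 (b + n : ℤ)) ∧
      ∀ a : ℤ, (a : ℝ) ∈ N → nu2 (a + n : ℤ) < nu2 n) ↔ ValCondI P N n := by
  have hPpos : ∀ l : ℤ, l ≠ 0 → (l : ℝ) ∈ P → 0 < l := fun l hl h =>
    lt_of_le_of_ne (hP l h) hl.symm
  constructor
  · rintro ⟨h, hlt⟩ l a b hl hlP ha hb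
    have h1 := h l a b hl hlP ha hb
    have ha1 := hlt a ha
    have h3 := nu2_add_natCast_cases hn (hN a ha)
    have h4 := nu2_add_natCast_cases hn (hN b hb)
    have h5 := nu2_add_natCast_cases hn (hPpos l hl hlP)
    omega
  · intro h
    refine ⟨fun l a b hl hlP ha hb => ?_, fun a ha => ?_⟩
    · have := h l a b hl hlP ha hb
      have h3 := nu2_add_natCast_cases hn (hN a ha)
      have h4 := nu2_add_natCast_cases hn (hN b hb)
      have h5 := nu2_add_natCast_cases hn (hPpos l hl hlP)
      omega
    · obtain ⟨l, hl, hlP⟩ := hPne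
      have := h l a a hl hlP ha ha
      have h3 := nu2_add_natCast_cases hn (hN a ha)
      omega

lemma nu2_lt_nu2_two_add_iff (hn : n ≠ 0) : nu2 (n : ℤ) < nu2 (2 + n : ℤ) ↔ n % 4 = 2 := by
  have hval : nu2 (n : ℤ) = 1 ↔ n % 4 = 2 := by
    constructor
    · intro h
      obtain ⟨k, q, hq, hk⟩ := exists_eq_two_pow_mul_odd (by omega : (n : ℤ) ≠ 0)
      obtain rfl : k = 1 := by omega
      omega
    · intro h
      obtain ⟨q, hq⟩ : ∃ q : ℤ, (n : ℤ) = 2 * (2 * q + 1) := ⟨n / 4, by omega⟩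
      rw [hq, Int.cast_mul, nu2_mul (by norm_num) (Int.cast_ne_zero.2 (by omega)), nu2_odd,
        Int.cast_ofNat, nu2_two, add_zero]
  have h2 : nu2 (2 : ℤ) = 1 := nu2_two
  have hcast : nu2 (n : ℚ) = nu2 ((n : ℤ) : ℚ) := by simp
  have := nu2_add_natCast_cases hn (a := 2) (by norm_num)
  omega

end Valuations

/-! ### Aligning phases in a join -/

namespace WGraph

section Frequencies

variable {V W : Type*} [Fintype V] [DecidableEq V] [Fintype W] [DecidableEq W]
  (X : WGraph V) (Y : WGraph W)

/-- The frequencies that need phase `1` for state transfer between `u` and `v` in the join of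
`X ≠ O_2` with a graph on `n` vertices. The eigenvalue zero of the join is left out, its phase being
always `1`. -/
def plusFreq (n : ℕ) (u v : V) : Set ℝ :=
  {x | (∃ l ∈ sigmaPlus X.lap u v, l ≠ 0 ∧ x = l + n) ∨ x = Fintype.card V + n ∨
    (¬ X.graph.Connected ∧ x = n)}

/-- The frequencies that need phase `-1` for state transfer between `u` and `v` in the join of
`X ≠ O_2` with a graph on `n` vertices. -/
def minusFreq (n : ℕ) (u v : V) : Set ℝ :=
  {x | ∃ l ∈ sigmaMinus X.lap u v, x = l + n}

variable {X} {u v : V}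

/-- Since `y` is real, a phase that takes `y v` to `y u` is `1` or `-1` unless both are zero. -/
lemma phase_cases {l : ℝ} {t : ℝ} {n : ℕ}
    (h : ∀ y : V → ℝ, X.lap *ᵥ y = l • y →
      Complex.exp (Complex.I * t * (l + n : ℝ)) * y v = y u) :
    (∀ y : V → ℝ, X.lap *ᵥ y = l • y → y u = 0 ∧ y v = 0) ∨
    (Complex.exp (Complex.I * t * (l + n : ℝ)) = 1 ∧
      ∀ y : V → ℝ, X.lap *ᵥ y = l • y → y u = y v) ∨
    (Complex.exp (Complex.I * t * (l + n : ℝ)) = -1 ∧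
      ∀ y : V → ℝ, X.lap *ᵥ y = l • y → y u = -y v) := by
  by_cases h0 : ∃ y : V → ℝ, X.lap *ᵥ y = l • y ∧ y v ≠ 0
  · obtain ⟨y, hy, hyv⟩ := h0
    have hnorm := norm_exp_I_mul t (l + n)
    have hreal : Complex.exp (Complex.I * t * (l + n : ℝ)) = ((y u / y v : ℝ) : ℂ) := by
      rw [Complex.ofReal_div, eq_div_iff (by exact_mod_cast hyv), h y hy]
    rw [hreal, Complex.norm_real, Real.norm_eq_abs, abs_eq zero_le_one] at hnorm
    rcases hnorm with h1 | h1
    · refine Or.inr (Or.inl ⟨by rw [hreal, h1]; simp, fun z hz => ?_⟩)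
      have := h z hz
      rw [hreal, h1] at this
      simpa [eq_comm] using this
    · refine Or.inr (Or.inr ⟨by rw [hreal, h1]; simp, fun z hz => ?_⟩)
      have := h z hz
      rw [hreal, h1] at this
      have h2 : (((-z v : ℝ)) : ℂ) = z u := by rw [← this]; simp
      exact (Complex.ofReal_injective h2).symm
  · push Not at h0
    refine Or.inl fun y hy => ⟨?_, h0 y hy⟩
    have := h y hy
    rw [h0 y hy] at this
    simpa [eq_comm] using this

/-- State transfer between different components of `X` forces both ends to be isolated vertices,
because an eigenvector with nonzero eigenvalue can be restricted to the component of either end;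
the indicator vector of `u` then shows that `X` has no further vertices. -/
lemma reachable_of_pstAt_join [Nonempty W] (huv : u ≠ v) (hO : ¬ X.IsO2) {t : ℝ}
    (h : PSTAt (X.join Y).lap (Sum.inl u) (Sum.inl v) t) : X.graph.Reachable u v := by
  classical
  have : Nonempty V := ⟨u⟩
  by_contra hr
  obtain ⟨-, h⟩ := (pstAt_join_iff X Y).1 h
  -- all eigenvectors with nonzero eigenvalue vanish at `u`
  have hcol : ∀ y : V → ℝ, (X.lap *ᵥ y) u = 0 := by
    have := eq_zero_of_forall_eigenvector X.lap_isHermitian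
      ((LinearMap.proj u : (V → ℝ) →ₗ[ℝ] ℝ).comp X.lap.mulVecLin) (by
        intro l y hy
        simp only [LinearMap.comp_apply, Matrix.mulVecLin_apply, hy, LinearMap.proj_apply,
          Pi.smul_apply, smul_eq_mul]
        by_cases hl : l = 0
        · rw [hl, zero_mul]
        have hy' := X.lap_mulVec_restrict hy u
        have := h l _ hy' (X.sum_eq_zero_of_eigenvector hy' hl)
        rw [if_neg hr, if_pos (SimpleGraph.Reachable.refl u)] at this
        have : y u = 0 := by simpa [eq_comm] using this
        rw [this, mul_zero])
    exact fun y => LinearMap.congr_fun this y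
  have hw : ∀ z, X.w u z = 0 := by
    have := hcol (Pi.single u 1)
    rw [lap_mulVec_apply] at this
    have hterm : ∀ z, X.w u z * ((Pi.single u 1 : V → ℝ) u - (Pi.single u 1 : V → ℝ) z) =
        X.w u z := by
      intro z
      by_cases hz : z = u
      · rw [hz, X.loopless, zero_mul]
      · simp [hz]
    simp only [hterm] at this
    intro z
    exact (Finset.sum_eq_zero_iff_of_nonneg (fun z _ => X.nonneg u z)).1 this z (Finset.mem_univ _)
  have hm : (0 : ℝ) < Fintype.card V := by exact_mod_cast Fintype.card_pos
  have hker : X.lap *ᵥ (Pi.single u 1 - (1 / (Fintype.card V : ℝ)) • fun _ => (1 : ℝ)) =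
      (0 : ℝ) • (Pi.single u 1 - (1 / (Fintype.card V : ℝ)) • fun _ => (1 : ℝ)) := by
    rw [Matrix.mulVec_sub, Matrix.mulVec_smul, lap_mulVec_one, smul_zero, sub_zero, zero_smul]
    ext x
    rw [lap_mulVec_apply]
    refine Finset.sum_eq_zero fun z _ => ?_
    by_cases hx : x = u
    · rw [hx, hw, zero_mul]
    by_cases hz : z = u
    · rw [hz, X.symm, hw, zero_mul]
    · simp [hx, hz]
  -- the entries `1 - 1 / m` and `-1 / m` of this kernel vector have equal modulus only if `m = 2`
  have hphase := h 0 _ hker (by simp [Finset.sum_sub_distrib])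
  have hnorm := congrArg norm hphase
  rw [norm_mul, norm_exp_I_mul, one_mul, Complex.norm_real, Complex.norm_real] at hnorm
  simp only [Pi.sub_apply, Pi.single_eq_of_ne huv.symm, Pi.smul_apply, smul_eq_mul, mul_one,
    zero_sub, norm_neg, Pi.single_eq_same, Real.norm_eq_abs] at hnorm
  have hcard : 2 ≤ Fintype.card V := Fintype.one_lt_card_iff.2 ⟨u, v, huv⟩
  have hcard' : (2 : ℝ) ≤ Fintype.card V := by exact_mod_cast hcard
  have hle : 1 / (Fintype.card V : ℝ) ≤ 1 / 2 := one_div_le_one_div_of_le two_pos hcard'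
  rw [abs_of_pos (by positivity), abs_of_pos (by linarith)] at hnorm
  have hm2 : (Fintype.card V : ℝ) = 2 := by
    have : 1 / (Fintype.card V : ℝ) = 1 / 2 := by linarith
    field_simp at this
    linarith
  have hm2' : Fintype.card V = 2 := by exact_mod_cast hm2
  refine hO ⟨hm2', ?_⟩
  have hall : ∀ x, x = u ∨ x = v := by
    intro x
    by_contra! hx
    have h3 : ({x, u, v} : Finset V).card = 3 := by
      rw [Finset.card_eq_three]
      exact ⟨x, u, v, hx.1, hx.2, huv, rfl⟩
    have := Finset.card_le_univ ({x, u, v} : Finset V)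
    omega
  ext x z
  simp only [graph, SimpleGraph.bot_adj, iff_false, not_lt]
  rcases hall x with rfl | rfl
  · rw [hw]
  · rcases hall z with rfl | rfl
    · rw [X.symm, hw]
    · rw [X.loopless]

/-- The eigenspace of the join for `n` comes from the kernel of the Laplacian of `X`, where `u` and
`v`, being in the same component, have the same sign; it contributes only if `X` is
disconnected. -/
lemma pstAt_join_iff_phasesAlign [Nonempty W] (huv : u ≠ v) (hO : ¬ X.IsO2) {t : ℝ} :
    PSTAt (X.join Y).lap (Sum.inl u) (Sum.inl v) t ↔
      (StronglyCospectral X.lap u v ∧ (Fintype.card V : ℝ) ∉ sigmaMinus X.lap u v) ∧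
        PhasesAlign (X.plusFreq (Fintype.card W) u v) (X.minusFreq (Fintype.card W) u v) t := by
  have : Nonempty V := ⟨u⟩
  constructor
  · intro hpst
    have hr := reachable_of_pstAt_join Y huv hO hpst
    obtain ⟨h1, h⟩ := (pstAt_join_iff X Y).1 hpst
    have hcases : ∀ l : ℝ, l ≠ 0 → _ := fun l hl => phase_cases (X := X) (u := u) (v := v) (l := l)
      (t := t) (n := Fintype.card W)
      fun y hy => h l y hy (X.sum_eq_zero_of_eigenvector hy hl)
    have hminus : ∀ l ∈ sigmaMinus X.lap u v,
        Complex.exp (Complex.I * t * (l + Fintype.card W : ℝ)) = -1 := by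
      rintro l hl
      have hl0 : l ≠ 0 := by
        rintro rfl
        exact X.zero_notMem_sigmaMinus hl
      obtain ⟨y, hy, hyv⟩ := eigProj_ne_zero_iff.1 hl.2
      rcases hcases l hl0 with hc | hc | hc
      · exact absurd (hc y hy).2 hyv
      · have e1 := hc.2 y hy
        have e2 := eigProj_eq_neg_iff.1 hl.1 y hy
        exact absurd (by linarith) hyv
      · exact hc.1
    refine ⟨⟨fun l => ?_, fun hm => ?_⟩, ?_, ?_⟩
    · by_cases hl : l = 0
      · refine Or.inl (eigProj_eq_iff.2 fun y hy => X.eq_of_reachable ?_ hr)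
        rw [hy, hl, zero_smul]
      · rcases hcases l hl with hc | hc | hc
        · exact Or.inl (eigProj_eq_iff.2 fun y hy => by rw [(hc y hy).1, (hc y hy).2])
        · exact Or.inl (eigProj_eq_iff.2 hc.2)
        · exact Or.inr (eigProj_eq_neg_iff.2 hc.2)
    · have := hminus _ hm
      rw [h1] at this
      norm_num at this
    · rintro x (⟨l, hl, hl0, rfl⟩ | rfl | ⟨hconn, rfl⟩)
      · obtain ⟨y, hy, hyv⟩ := eigProj_ne_zero_iff.1 hl.2
        rcases hcases l hl0 with hc | hc | hc
        · exact absurd (hc y hy).2 hyv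
        · exact hc.1
        · have e1 := hc.2 y hy
          have e2 := eigProj_eq_iff.1 hl.1 y hy
          exact absurd (by linarith) hyv
      · exact h1
      · have hc : ∃ x, ¬ X.graph.Reachable u x := by
          by_contra! hall
          exact hconn ((SimpleGraph.connected_iff _).2
            ⟨fun a b => (hall a).symm.trans (hall b), inferInstance⟩)
        obtain ⟨y, hy, hsum, s, hs1, hy1⟩ := X.exists_component_vector hc
        have := h 0 y (by rw [hy, zero_smul]) hsum
        rw [hy1 u (SimpleGraph.Reachable.refl u), hy1 v hr, zero_add] at this
        refine (mul_eq_right₀ ?_).1 this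
        exact_mod_cast (by linarith : (1 - s : ℝ) ≠ 0)
    · rintro x ⟨l, hl, rfl⟩
      exact hminus l hl
  · rintro ⟨⟨hsc, -⟩, hplus, hminus⟩
    refine (pstAt_join_iff X Y).2 ⟨hplus _ (Or.inr (Or.inl rfl)), fun l y hy hsum => ?_⟩
    by_cases hyv : eigProj X.lap l v = 0
    · have hyu : eigProj X.lap l u = 0 := by
        rcases hsc l with h | h <;> simp [h, hyv]
      have e1 := eigProj_eq_smul_iff (M := X.lap) (l := l) (u := u) (v := u) 0
      have e2 := eigProj_eq_smul_iff (M := X.lap) (l := l) (u := v) (v := v) 0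
      simp only [zero_smul, zero_mul] at e1 e2
      rw [e1.1 hyu y hy, e2.1 hyv y hy, Complex.ofReal_zero, mul_zero]
    · rcases hsc l with h | h
      · by_cases hl : l = 0
        · subst hl
          rw [zero_smul] at hy
          by_cases hconn : X.graph.Connected
          · have hconst : ∀ x, y x = y u := fun x => X.eq_of_reachable hy (hconn.preconnected x u)
            have hyu : y u = 0 := by
              simp only [hconst, Finset.sum_const, Finset.card_univ, nsmul_eq_mul] at hsum
              exact (mul_eq_zero.1 hsum).resolve_left (by exact_mod_cast Fintype.card_ne_zero)
            rw [hconst v, hyu, Complex.ofReal_zero, mul_zero]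
          · rw [zero_add, hplus _ (Or.inr (Or.inr ⟨hconn, rfl⟩)), one_mul,
              eigProj_eq_iff.1 h y (by rw [hy, zero_smul])]
        · rw [hplus _ (Or.inl ⟨l, ⟨h, hyv⟩, hl, rfl⟩), one_mul, eigProj_eq_iff.1 h y hy]
      · rw [hminus _ ⟨l, ⟨h, hyv⟩, rfl⟩, eigProj_eq_neg_iff.1 h y hy]
        simp

lemma sigmaMinus_nonempty (huv : u ≠ v) (hsc : StronglyCospectral X.lap u v) :
    (sigmaMinus X.lap u v).Nonempty := by
  by_contra hne
  rw [Set.not_nonempty_iff_eq_empty] at hne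
  have := eq_zero_of_forall_eigenvector X.lap_isHermitian
    ((LinearMap.proj u : (V → ℝ) →ₗ[ℝ] ℝ) - LinearMap.proj v) (by
      intro l y hy
      have heq : eigProj X.lap l u = eigProj X.lap l v := by
        rcases hsc l with h | h
        · exact h
        · by_cases h0 : eigProj X.lap l v = 0
          · rw [h, h0, neg_zero]
          · exact absurd (hne ▸ (⟨h, h0⟩ : l ∈ sigmaMinus X.lap u v)) (Set.notMem_empty l)
      simp [eigProj_eq_iff.1 heq y hy])
  have h2 := LinearMap.congr_fun this (Pi.single u 1)
  simp [Pi.single_eq_of_ne huv.symm] at h2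

lemma eigSupport_eq_union (hsc : StronglyCospectral X.lap u v) :
    eigSupport X.lap u = sigmaPlus X.lap u v ∪ sigmaMinus X.lap u v := by
  ext l
  constructor
  · intro h
    have h' : eigProj X.lap l u ≠ 0 := h
    rcases hsc l with e | e
    · exact Or.inl ⟨e, e ▸ h'⟩
    · exact Or.inr ⟨e, fun h0 => h' (by rw [e, h0, neg_zero])⟩
  · rintro (⟨e, h⟩ | ⟨e, h⟩) <;> change eigProj X.lap l u ≠ 0 <;> rw [e]
    · exact h
    · exact neg_ne_zero.2 h

/-- At a time `t` of alignment `t (m + n) / π` and all `t (l + n) / π` are integers, so the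
eigenvalues in the support of `u` are rational. -/
lemma eigSupport_int_of_phasesAlign {n : ℕ}
    (hX : ∃ p : Polynomial ℤ, p.map (Int.castRingHom ℝ) = X.lap.charpoly) (huv : u ≠ v)
    (hsc : StronglyCospectral X.lap u v) {t : ℝ}
    (ht : PhasesAlign (X.plusFreq n u v) (X.minusFreq n u v) t) :
    ∀ l ∈ eigSupport X.lap u, ∃ k : ℤ, l = k := by
  intro l hl
  by_cases hl0 : l = 0
  · exact ⟨0, by simp [hl0]⟩
  have hm : (0 : ℝ) < Fintype.card V := by exact_mod_cast Fintype.card_pos_iff.2 ⟨u⟩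
  have ht0 : t ≠ 0 := by
    rintro rfl
    obtain ⟨a, ha⟩ := sigmaMinus_nonempty huv hsc
    have := ht.2 _ ⟨a, ha, rfl⟩
    norm_num at this
  have hj : ∃ j : ℤ, t * (l + n) = j * Real.pi := by
    rw [eigSupport_eq_union hsc] at hl
    rcases hl with hl | hl
    · obtain ⟨k, hk⟩ := exp_I_mul_eq_one_iff.1 (ht.1 _ (Or.inl ⟨l, hl, hl0, rfl⟩))
      exact ⟨2 * k, by rw [hk]; push_cast; ring⟩
    · obtain ⟨k, hk⟩ := exp_I_mul_eq_neg_one_iff.1 (ht.2 _ ⟨l, hl, rfl⟩)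
      exact ⟨2 * k + 1, by rw [hk]; push_cast; ring⟩
  obtain ⟨j, hj⟩ := hj
  obtain ⟨k, hk⟩ := exp_I_mul_eq_one_iff.1 (ht.1 _ (Or.inr (Or.inl rfl)))
  have hk0 : (k : ℝ) ≠ 0 := by
    intro h
    rw [h, mul_zero, zero_mul] at hk
    rcases mul_eq_zero.1 hk with h | h
    · exact ht0 h
    · have : (0 : ℝ) ≤ n := Nat.cast_nonneg n
      linarith
  refine eigSupport_int_of_rat hl hX (q := j * (Fintype.card V + n) / (2 * k) - n) ?_
  push_cast
  rw [eq_sub_iff_add_eq, eq_div_iff (mul_ne_zero two_ne_zero hk0)]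
  refine mul_left_cancel₀ (mul_ne_zero ht0 Real.pi_ne_zero) ?_
  linear_combination (2 * k * Real.pi : ℝ) * hj - (j * Real.pi : ℝ) * hk

lemma eigSupport_nonneg {l : ℝ} (hl : l ∈ eigSupport X.lap u) : 0 ≤ l := by
  obtain ⟨y, hy, hyu⟩ := eigProj_ne_zero_iff.1 hl
  exact X.eigenvalue_nonneg hy hyu

lemma plusFreq_int {n : ℕ}
    (hint : ∀ l ∈ sigmaPlus X.lap u v ∪ sigmaMinus X.lap u v, ∃ k : ℤ, l = k) :
    ∀ x ∈ X.plusFreq n u v, ∃ k : ℤ, x = k := by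
  rintro x (⟨l, hl, hl0, rfl⟩ | rfl | ⟨hc, rfl⟩)
  · obtain ⟨k, rfl⟩ := hint l (Or.inl hl)
    exact ⟨k + n, by push_cast; rfl⟩
  · exact ⟨Fintype.card V + n, by push_cast; rfl⟩
  · exact ⟨n, by simp⟩

lemma minusFreq_int {n : ℕ}
    (hint : ∀ l ∈ sigmaPlus X.lap u v ∪ sigmaMinus X.lap u v, ∃ k : ℤ, l = k) :
    ∀ x ∈ X.minusFreq n u v, ∃ k : ℤ, x = k := by
  rintro x ⟨l, hl, rfl⟩
  obtain ⟨k, rfl⟩ := hint l (Or.inr hl)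
  exact ⟨k + n, by push_cast; rfl⟩

lemma exists_phasesAlign_freq_iff {n : ℕ} (hn : n ≠ 0) (huv : u ≠ v)
    (hsc : StronglyCospectral X.lap u v) (hint : ∀ l ∈ eigSupport X.lap u, ∃ k : ℤ, l = k) :
    (∃ t, PhasesAlign (X.plusFreq n u v) (X.minusFreq n u v) t) ↔
      (X.graph.Connected ∧
          (ValCondI (sigmaPlus X.lap u v ∪ {(Fintype.card V : ℝ)}) (sigmaMinus X.lap u v) n ∨
            ValCondII (sigmaPlus X.lap u v ∪ {(Fintype.card V : ℝ)}) (sigmaMinus X.lap u v) n ∨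
            ValCondIII (sigmaPlus X.lap u v ∪ {(Fintype.card V : ℝ)}) (sigmaMinus X.lap u v) n)) ∨
        (¬ X.graph.Connected ∧
          ValCondI (sigmaPlus X.lap u v ∪ {(Fintype.card V : ℝ)}) (sigmaMinus X.lap u v) n) := by
  rw [eigSupport_eq_union hsc] at hint
  have hnn : ∀ l ∈ sigmaPlus X.lap u v ∪ sigmaMinus X.lap u v, 0 ≤ l := fun l hl =>
    eigSupport_nonneg (by rwa [eigSupport_eq_union hsc])
  have hmpos : 0 < Fintype.card V := Fintype.card_pos_iff.2 ⟨u⟩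
  have hmpos' : (0 : ℝ) < Fintype.card V := by exact_mod_cast hmpos
  have hnpos : (0 : ℝ) < n := by exact_mod_cast Nat.pos_of_ne_zero hn
  set P := sigmaPlus X.lap u v ∪ {(Fintype.card V : ℝ)} with hPdef
  set N := sigmaMinus X.lap u v with hNdef
  have hP : ∀ l : ℤ, (l : ℝ) ∈ P → 0 ≤ l := by
    rintro l (hl | hl)
    · exact_mod_cast hnn _ (Or.inl hl)
    · have h2 : (l : ℝ) = (Fintype.card V : ℝ) := hl
      have h3 : l = (Fintype.card V : ℤ) := by exact_mod_cast h2
      omega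
  have hN : ∀ a : ℤ, (a : ℝ) ∈ N → 0 < a := by
    intro a ha
    refine lt_of_le_of_ne (by exact_mod_cast hnn _ (Or.inr ha)) fun h => ?_
    subst h
    exact X.zero_notMem_sigmaMinus (by simpa using ha)
  have hPne : ∃ l : ℤ, l ≠ 0 ∧ (l : ℝ) ∈ P := ⟨Fintype.card V, by omega, Or.inr (by simp)⟩
  have hNne : ∃ a : ℤ, (a : ℝ) ∈ N := by
    obtain ⟨a, ha⟩ := sigmaMinus_nonempty huv hsc
    obtain ⟨k, rfl⟩ := hint a (Or.inr ha)
    exact ⟨k, ha⟩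
  have hplus : ∀ x : ℤ, (x : ℝ) ∈ X.plusFreq n u v ↔
      (∃ l : ℤ, l ≠ 0 ∧ (l : ℝ) ∈ P ∧ x = l + n) ∨ (¬ X.graph.Connected ∧ x = n) := by
    intro x
    constructor
    · rintro (⟨l, hl, hl0, hx⟩ | hx | ⟨hc, hx⟩)
      · obtain ⟨k, rfl⟩ := hint l (Or.inl hl)
        exact Or.inl ⟨k, by exact_mod_cast hl0, Or.inl hl, by exact_mod_cast hx⟩
      · exact Or.inl ⟨Fintype.card V, by omega, Or.inr (by simp), by exact_mod_cast hx⟩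
      · exact Or.inr ⟨hc, by exact_mod_cast hx⟩
    · rintro (⟨l, hl0, hl | hl, rfl⟩ | ⟨hc, rfl⟩)
      · exact Or.inl ⟨l, hl, by exact_mod_cast hl0, by push_cast; rfl⟩
      · have h2 : (l : ℝ) = (Fintype.card V : ℝ) := hl
        exact Or.inr (Or.inl (by push_cast; rw [h2]))
      · exact Or.inr (Or.inr ⟨hc, by simp⟩)
  have hminus : ∀ x : ℤ, (x : ℝ) ∈ X.minusFreq n u v ↔ ∃ a : ℤ, (a : ℝ) ∈ N ∧ x = a + n := by
    intro x
    constructor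
    · rintro ⟨a, ha, hx⟩
      obtain ⟨k, rfl⟩ := hint a (Or.inr ha)
      exact ⟨k, ha, by exact_mod_cast hx⟩
    · rintro ⟨a, ha, rfl⟩
      exact ⟨a, ha, by push_cast; rfl⟩
  have hkey : (∃ t, PhasesAlign (X.plusFreq n u v) (X.minusFreq n u v) t) ↔
      (∀ l a b : ℤ, l ≠ 0 → (l : ℝ) ∈ P → (a : ℝ) ∈ N → (b : ℝ) ∈ N →
        nu2 (a + n : ℤ) < nu2 (l + n : ℤ) ∧ nu2 (a + n : ℤ) = nu2 (b + n : ℤ)) ∧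
      (¬ X.graph.Connected → ∀ a : ℤ, (a : ℝ) ∈ N → nu2 (a + n : ℤ) < nu2 n) := by
    rw [exists_phasesAlign_iff]
    · constructor
      · refine fun h => ⟨fun l a b hl hlP ha hb => h (l + n) (a + n) (b + n)
          ((hplus _).2 (Or.inl ⟨l, hl, hlP, rfl⟩)) ((hminus _).2 ⟨a, ha, rfl⟩)
          ((hminus _).2 ⟨b, hb, rfl⟩), fun hc a ha => ?_⟩
        have := (h n (a + n) (a + n) ((hplus _).2 (Or.inr ⟨hc, rfl⟩))
          ((hminus _).2 ⟨a, ha, rfl⟩) ((hminus _).2 ⟨a, ha, rfl⟩)).1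
        simpa using this
      · rintro ⟨h, hc⟩ x a b hx ha hb
        obtain ⟨a, haN, rfl⟩ := (hminus _).1 ha
        obtain ⟨b, hbN, rfl⟩ := (hminus _).1 hb
        rcases (hplus _).1 hx with ⟨l, hl, hlP, rfl⟩ | ⟨hcon, rfl⟩
        · exact h l a b hl hlP haN hbN
        · obtain ⟨l, hl, hlP⟩ := hPne
          refine ⟨?_, (h l a b hl hlP haN hbN).2⟩
          simpa using hc hcon a haN
    · exact plusFreq_int hint
    · exact minusFreq_int hint
    · rintro (⟨l, hl, hl0, h⟩ | h | ⟨hc, h⟩)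
      · have := hnn l (Or.inl hl)
        linarith
      · linarith
      · linarith
    · rintro ⟨l, hl, h⟩
      have := hnn l (Or.inr hl)
      linarith
    · exact ⟨_, Or.inr (Or.inl rfl)⟩
    · obtain ⟨a, ha⟩ := hNne
      exact ⟨_, a, ha, rfl⟩
  rw [hkey]
  by_cases hc : X.graph.Connected
  · simp only [hc, not_true_eq_false, false_imp_iff, and_true, true_and, false_and, or_false]
    exact valuations_shift_iff (Nat.pos_of_ne_zero hn).ne' hP hN hPne hNne
  · simp only [hc, not_false_eq_true, true_imp_iff, true_and, false_and, false_or]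
    exact valuations_shift_and_iff hn hP hN hPne

lemma shiftedSupport_eq {n : ℕ} (hsc : StronglyCospectral X.lap u v) :
    shiftedSupport X n u = insert 0 (X.plusFreq n u v ∪ X.minusFreq n u v) := by
  have h0 : ∀ l ∈ sigmaMinus X.lap u v, l ≠ 0 := by
    rintro l hl rfl
    exact X.zero_notMem_sigmaMinus hl
  ext x
  simp only [shiftedSupport, plusFreq, minusFreq, eigSupport_eq_union hsc, Set.mem_union,
    Set.mem_insert_iff, Set.mem_ofPred_eq, Set.mem_singleton_iff]
  constructor
  · rintro ((⟨l, hl | hl, hl0, rfl⟩ | rfl | rfl) | h)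
    · exact Or.inr (Or.inl (Or.inl ⟨l, hl, hl0, rfl⟩))
    · exact Or.inr (Or.inr ⟨l, hl, rfl⟩)
    · exact Or.inl rfl
    · exact Or.inr (Or.inl (Or.inr (Or.inl rfl)))
    · exact Or.inr (Or.inl (Or.inr (Or.inr h)))
  · rintro (rfl | (⟨l, hl, hl0, rfl⟩ | rfl | h) | ⟨l, hl, rfl⟩)
    · exact Or.inl (Or.inr (Or.inl rfl))
    · exact Or.inl (Or.inl ⟨l, Or.inl hl, hl0, rfl⟩)
    · exact Or.inl (Or.inr (Or.inr rfl))
    · exact Or.inr h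
    · exact Or.inl (Or.inl ⟨l, Or.inr hl, h0 l hl, rfl⟩)

/-! ### Joins with `O_2` -/

lemma IsO2.lap_eq_zero (hO : X.IsO2) : X.lap = 0 := by
  have hw : ∀ x z, X.w x z = 0 := by
    intro x z
    refine le_antisymm (not_lt.1 fun h => ?_) (X.nonneg x z)
    have : X.graph.Adj x z := h
    rw [hO.2] at this
    exact this
  ext x z
  rw [lap, Matrix.sub_apply, adj, Matrix.of_apply, hw, Matrix.diagonal_apply, deg]
  simp [hw]

omit [DecidableEq V] in
lemma IsO2.not_connected (hO : X.IsO2) (huv : u ≠ v) : ¬ X.graph.Connected := by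
  intro h
  have := h.preconnected u v
  rw [hO.2, SimpleGraph.reachable_bot] at this
  exact huv this

/-- For `O_2` the only eigenvector orthogonal to the constants has opposite signs at `u` and `v`,
and it gives the eigenvalue `n` of the join. -/
lemma IsO2.pstAt_join_iff_phasesAlign [Nonempty W] (huv : u ≠ v) (hO : X.IsO2) {t : ℝ} :
    PSTAt (X.join Y).lap (Sum.inl u) (Sum.inl v) t ↔
      PhasesAlign {(2 + Fintype.card W : ℝ)} {(Fintype.card W : ℝ)} t := by
  have : Nonempty V := ⟨u⟩
  have hsum : ∀ y : V → ℝ, ∑ x, y x = y u + y v := by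
    intro y
    have huniv : ({u, v} : Finset V) = Finset.univ := by
      rw [← Finset.card_eq_iff_eq_univ, Finset.card_pair huv, hO.1]
    rw [← huniv, Finset.sum_pair huv]
  rw [pstAt_join_iff, hO.lap_eq_zero, hO.1, PhasesAlign]
  simp only [Set.mem_singleton_iff, forall_eq, Nat.cast_ofNat]
  refine and_congr_right fun _ => ⟨fun h => ?_, fun h l y hy hs => ?_⟩
  · have := h 0 (Pi.single u 1 - Pi.single v 1) (by simp) (by simp [Finset.sum_sub_distrib])
    simp only [Pi.sub_apply, Pi.single_eq_same, Pi.single_eq_of_ne huv,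
      Pi.single_eq_of_ne huv.symm, zero_add] at this
    push_cast at this ⊢
    linear_combination -this
  · by_cases hl : l = 0
    · rw [hsum] at hs
      rw [hl, zero_add, h, eq_neg_of_add_eq_zero_left hs]
      simp
    · have hy0 : y = 0 := by
        rw [Matrix.zero_mulVec] at hy
        exact (smul_eq_zero.1 hy.symm).resolve_left hl
      simp [hy0]

lemma IsO2.eq_zero_of_mem_eigSupport (hO : X.IsO2) {l : ℝ} (hl : l ∈ eigSupport X.lap u) :
    l = 0 := by
  obtain ⟨y, hy, hyu⟩ := eigProj_ne_zero_iff.1 hl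
  rw [hO.lap_eq_zero, Matrix.zero_mulVec] at hy
  have := congrFun hy u
  exact (mul_eq_zero.1 this.symm).resolve_right hyu

lemma IsO2.shiftedSupport_eq {n : ℕ} (huv : u ≠ v) (hO : X.IsO2) :
    shiftedSupport X n u = insert 0 ({(2 + n : ℝ)} ∪ {(n : ℝ)}) := by
  have hc := hO.not_connected huv
  ext x
  simp only [shiftedSupport, hc, hO.1, Set.mem_union, Set.mem_insert_iff, Set.mem_ofPred_eq,
    Set.mem_singleton_iff, not_false_eq_true, true_and, Nat.cast_ofNat]
  constructor
  · rintro ((⟨l, hl, hl0, -⟩ | h) | h)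
    · exact absurd (hO.eq_zero_of_mem_eigSupport hl) hl0
    · tauto
    · tauto
  · tauto

lemma IsO2.pst_join_iff [Nonempty W] (huv : u ≠ v) (hO : X.IsO2) :
    PST (X.join Y).lap (Sum.inl u) (Sum.inl v) ↔ Fintype.card W % 4 = 2 := by
  have hn : Fintype.card W ≠ 0 := Fintype.card_ne_zero
  have hn' : (0 : ℝ) < Fintype.card W := by exact_mod_cast Fintype.card_pos
  rw [← nu2_lt_nu2_two_add_iff hn]
  simp only [PST, hO.pstAt_join_iff_phasesAlign Y huv]
  rw [exists_phasesAlign_iff]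
  · constructor
    · intro h
      exact (h (2 + Fintype.card W) (Fintype.card W) (Fintype.card W) (by simp) (by simp)
        (by simp)).1
    · intro h x a b hx ha hb
      rw [Set.mem_singleton_iff] at hx ha hb
      obtain rfl : x = 2 + Fintype.card W := by exact_mod_cast hx
      obtain rfl : a = Fintype.card W := by exact_mod_cast ha
      obtain rfl : b = Fintype.card W := by exact_mod_cast hb
      exact ⟨h, rfl⟩
  · rintro x rfl
    exact ⟨2 + Fintype.card W, by push_cast; rfl⟩
  · rintro x rfl
    exact ⟨Fintype.card W, by simp⟩
  · intro h
    rw [Set.mem_singleton_iff] at h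
    linarith
  · intro h
    rw [Set.mem_singleton_iff] at h
    linarith
  · exact Set.singleton_nonempty _
  · exact Set.singleton_nonempty _

end Frequencies

end WGraph

/-! ### Perfect state transfer in joins -/

theorem theorem7p2 {V W : Type*} [Fintype V] [DecidableEq V] [Fintype W] [DecidableEq W]
    [Nonempty W] (X : WGraph V) (Y : WGraph W) (m n : ℕ)
    (hm : Fintype.card V = m) (hn : Fintype.card W = n) (hm2 : 2 ≤ m)
    (hX : ∃ p : Polynomial ℤ, p.map (Int.castRingHom ℝ) = X.lap.charpoly)
    (u v : V) (huv : u ≠ v) :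
    -- the characterization
    (PST (X.join Y).lap (Sum.inl u) (Sum.inl v) ↔
      ((StronglyCospectral X.lap u v ∧ (m : ℝ) ∉ sigmaMinus X.lap u v) ∨ X.IsO2) ∧
      (∀ l ∈ eigSupport X.lap u, ∃ k : ℤ, l = k) ∧
      ((X.graph.Connected ∧
          (ValCondI (sigmaPlus X.lap u v ∪ {(m : ℝ)}) (sigmaMinus X.lap u v) n ∨
            ValCondII (sigmaPlus X.lap u v ∪ {(m : ℝ)}) (sigmaMinus X.lap u v) n ∨
            ValCondIII (sigmaPlus X.lap u v ∪ {(m : ℝ)}) (sigmaMinus X.lap u v) n)) ∨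
        (¬ X.IsO2 ∧ ¬ X.graph.Connected ∧
          ValCondI (sigmaPlus X.lap u v ∪ {(m : ℝ)}) (sigmaMinus X.lap u v) n) ∨
        (X.IsO2 ∧ n % 4 = 2))) ∧
    -- in the disconnected case, `u` and `v` lie in the same component of `X`
    (PST (X.join Y).lap (Sum.inl u) (Sum.inl v) → ¬ X.IsO2 → ¬ X.graph.Connected →
      X.graph.Reachable u v) ∧
    -- the minimum PST time
    (PST (X.join Y).lap (Sum.inl u) (Sum.inl v) →
      ∃ g : ℕ, IsGcdOf g (shiftedSupport X n u) ∧
        IsMinPSTTime (X.join Y).lap (Sum.inl u) (Sum.inl v) (Real.pi / g)) := by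
  subst hm hn
  have hn0 : Fintype.card W ≠ 0 := Fintype.card_ne_zero
  by_cases hO : X.IsO2
  · have hc := hO.not_connected huv
    have hiff := hO.pst_join_iff Y huv
    refine ⟨?_, fun _ h => absurd hO h, fun hpst => ?_⟩
    · rw [hiff]
      constructor
      · exact fun h => ⟨Or.inr hO, fun l hl => ⟨0, by rw [hO.eq_zero_of_mem_eigSupport hl]; simp⟩,
          Or.inr (Or.inr ⟨hO, h⟩)⟩
      · rintro ⟨-, -, h | h | h⟩
        · exact absurd h.1 hc
        · exact absurd hO h.1
        · exact h.2
    · rw [hO.shiftedSupport_eq huv]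
      simp only [IsMinPSTTime, PST, hO.pstAt_join_iff_phasesAlign Y huv] at hpst ⊢
      refine exists_isGcdOf_isLeast_phasesAlign ?_ ?_ (Set.singleton_nonempty _) hpst
      · rintro x rfl
        exact ⟨2 + Fintype.card W, by push_cast; rfl⟩
      · rintro x rfl
        exact ⟨Fintype.card W, by simp⟩
  · have hiff : ∀ t, _ := fun t => WGraph.pstAt_join_iff_phasesAlign (X := X) Y huv hO (t := t)
    refine ⟨?_, ?_, ?_⟩
    · constructor
      · rintro ⟨t, ht⟩
        obtain ⟨hsc, hph⟩ := (hiff t).1 ht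
        have hint := WGraph.eigSupport_int_of_phasesAlign hX huv hsc.1 hph
        refine ⟨Or.inl hsc, hint, ?_⟩
        rcases (WGraph.exists_phasesAlign_freq_iff hn0 huv hsc.1 hint).1 ⟨t, hph⟩ with h | h
        · exact Or.inl h
        · exact Or.inr (Or.inl ⟨hO, h⟩)
      · rintro ⟨hsc | hO', hint, h⟩
        · obtain ⟨t, ht⟩ := (WGraph.exists_phasesAlign_freq_iff hn0 huv hsc.1 hint).2 (by
            rcases h with h | h | h
            · exact Or.inl h
            · exact Or.inr h.2
            · exact absurd h.1 hO)
          exact ⟨t, (hiff t).2 ⟨hsc, ht⟩⟩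
        · exact absurd hO' hO
    · rintro ⟨t, ht⟩ - -
      exact WGraph.reachable_of_pstAt_join Y huv hO ht
    · rintro ⟨t, ht⟩
      obtain ⟨hsc, hph⟩ := (hiff t).1 ht
      have hint := WGraph.eigSupport_int_of_phasesAlign hX huv hsc.1 hph
      rw [WGraph.shiftedSupport_eq hsc.1]
      simp only [IsMinPSTTime, hiff, hsc, true_and, and_self, not_false_eq_true]
      rw [WGraph.eigSupport_eq_union hsc.1] at hint
      refine exists_isGcdOf_isLeast_phasesAlign (WGraph.plusFreq_int hint)
        (WGraph.minusFreq_int hint) ?_ ⟨t, hph⟩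
      obtain ⟨a, ha⟩ := WGraph.sigmaMinus_nonempty huv hsc.1
      exact ⟨_, a, ha, rfl⟩
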